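/- Let $\xi$ be a random variable with values in $\{0,1,2,\dots\}$ such that $\mathbb E\,\xi=1$ and $0<\operatorname{Var}\xi<\infty$. Let $\mathcal T$ be the Galton–Watson tree with offspring distribution $\xi$, a random rooted ordered tree with $|\mathcal T|$ vertices, and for every $n\ge1$ with $\mathbb P(|\mathcal T|=n)>0$ let $T_n$ denote $\mathcal T$ conditioned on $|\mathcal T|=n$. For a rooted tree $\tau$ and $k\ge1$, let $Q_k(\tau)$ be the number of unordered pairs of vertices of $\tau$ at graph distance $k$ from each other such that the path between them visits the root (which may be one of its endpoints). 1. There is a constant $C>0$, depending only on the distribution of $\xi$, such that $$\mathbb E\,Q_k(T_n)\le C\,k\sqrt n$$ for all $k\ge1$ and all $n\ge1$ with $\mathbb P(|\mathcal T|=n)>0$. 2. This order is sharp when $k$ is of order $\sqrt n$: for all real $0<a\le b$ there are $c>0$ and $N$, depending only on $a$, $b$ and the distribution of $\xi$, such that $$\mathbb E\,Q_k(T_n)\ge c\,k\sqrt n$$ for all $n\ge N$ with $\mathbb P(|\mathcal T|=n)>0$ and all integers $k$ with $a\sqrt n\le k\le b\sqrt n$. -/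

import Mathlib

open MeasureTheory ProbabilityTheory
open scoped ENNReal

namespace GaltonWatson

/-- The infinite Ulam-Harris tree. Individuals are finite words over `ℕ`, the root is the empty
word, and the children of `u` are the words `u ++ [i]`; the edges join parents and children. -/
def ulamHarris : SimpleGraph (List ℕ) where
  Adj u v := (∃ i, v = u ++ [i]) ∨ (∃ i, u = v ++ [i])
  symm := ⟨fun _ _ h => h.symm⟩
  loopless := ⟨by
    rintro u (⟨i, h⟩ | ⟨i, h⟩) <;> simp at h⟩

/-- The family tree in which the individual `v`, if it is ever born, has the `ω v` children
`v ++ [0], …, v ++ [ω v - 1]`. A word `u` belongs to the tree iff every step `v → v ++ [i]` on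
the way from the root to `u` goes to an existing child. -/
def familyTree (ω : List ℕ → ℕ) : Set (List ℕ) :=
  {u | ∀ v i, v ++ [i] <+: u → i < ω v}

/-- The root is always in the family tree. -/
theorem nil_mem_familyTree (ω : List ℕ → ℕ) : [] ∈ familyTree ω := by
  intro v i h
  simp at h

/-- A non-root word is in the family tree iff its parent `u` is and it is one of the `ω u`
children of `u`. -/
theorem append_mem_familyTree (ω : List ℕ → ℕ) (u : List ℕ) (i : ℕ) :
    u ++ [i] ∈ familyTree ω ↔ u ∈ familyTree ω ∧ i < ω u := by
  constructor
  · intro h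
    exact ⟨fun v j hv => h v j (hv.trans (List.prefix_append u [i])), h u i List.prefix_rfl⟩
  · rintro ⟨hu, hi⟩ v j hv
    rcases List.prefix_concat_iff.1 hv with h | h
    · obtain ⟨rfl, h2⟩ := List.append_inj' h rfl
      simp only [List.cons.injEq, and_true] at h2
      exact h2 ▸ hi
    · exact hu v j h

/-- `pairsThroughRoot k τ` is the number of unordered pairs of vertices of the rooted tree `τ`
(a set of words, with root the empty word and the edges inherited from the Ulam-Harris tree) at
graph distance `k` from each other such that the path between them visits the root. -/
noncomputable def pairsThroughRoot (k : ℕ) (τ : Set (List ℕ)) : ℕ :=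
  {s : Sym2 τ | ∃ v w : τ, s = s(v, w) ∧ (ulamHarris.induce τ).dist v w = k ∧
    ∃ P : (ulamHarris.induce τ).Walk v w, P.IsPath ∧
      ∃ r ∈ P.support, (r : List ℕ) = []}.ncard

/-- The law of the offspring numbers of all potential individuals: they are independent, each
with the offspring distribution `p`. Under this measure `familyTree` is the Galton-Watson tree
with offspring distribution `p`. -/
noncomputable def offspringLaw (p : PMF ℕ) : Measure (List ℕ → ℕ) :=
  Measure.infinitePi (fun _ : List ℕ => p.toMeasure)

/-- The event that the family tree has exactly `n` vertices. -/
def sizeEvent (n : ℕ) : Set (List ℕ → ℕ) :=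
  {ω | (familyTree ω).encard = n}

/-- The law of the offspring numbers conditioned on the family tree having `n` vertices. Under
this measure `familyTree` is the conditioned Galton-Watson tree of size `n`; it is a probability
measure as soon as `sizeEvent n` has positive probability. -/
noncomputable def conditionedLaw (p : PMF ℕ) (n : ℕ) : Measure (List ℕ → ℕ) :=
  cond (offspringLaw p) (sizeEvent n)

/-- The expected number of pairs of vertices at distance `k` whose connecting path visits the
root, in the conditioned Galton-Watson tree of size `n`. -/
noncomputable def expectedPairs (p : PMF ℕ) (k n : ℕ) : ℝ≥0∞ :=
  ∫⁻ ω, (pairsThroughRoot k (familyTree ω) : ℝ≥0∞) ∂(conditionedLaw p n)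

end GaltonWatson

/-! ### Power series with nonnegative coefficients, read as weights on the integers. -/

namespace GaltonWatson
open PowerSeries Finset.HasAntidiagonal

/-! Write `G` for the offspring generating function and `S` for that of the total progeny, so that
`S = X G(S)`. The expectation is a quotient of two coefficients of `X^n` (`expectedPairs_eq`): that
of trees weighted by the number of pairs, over that of `S`, which is `P(|T| = n)`.

The numerator is explicit. A pair joined through the root marks one or two ancestral lines. Each
edge of such a line has a factor `X G'(S)`, except that when there are two lines their two root
edges share the factor `X G''(S)/2`. This gives `X^k G'(S)^k S + (k-1) X^(k-1) (G''(S)/2)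
G'(S)^(k-2) S^2` (`treeGF_rootPairs`), the second term for `k ≥ 2`. As `E ξ = 1`, `G'` is a
probability generating function, that of the size-biased law shifted by one. So each coefficient is
an average, over a random number `N` of roots, of the probability that a forest of `N` independent
trees has a prescribed size `m`.

By the hitting time theorem (`mul_coeff_treeGF_pow`) that probability is `(N/m) P(S_m = m - N)`,
with `S_m` a sum of `m` offspring variables. Everything then rests on three estimates for `S_m`:
atoms are `O(m^(-1/2))` (`exists_coeff_pow_le`), `P(S_m = m - N) = O(1/N)`
(`exists_coeff_pow_sub_le`), and atoms on the lattice near the mean are at least of order `m^(-1/2)`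
(`exists_local_lower`). All three use only the second moment. The two bounds on atoms split off a
Bernoulli component, which reduces them to binomial coefficients.

Consequently `P(|T| = n)` is of order `n^(-3/2)` whenever it is nonzero, and a forest of any number
of trees has size `m` with probability `O(1/m)`. The numerator is thus `O(k/n)`, and the quotient
`O(k √n)`. When `k` is of order `√n`, so is `N` with probability bounded below (`exists_window`),
and then the forest probability is at least of order `1/n`; this gives the reverse inequality. -/

/-- The sum of `φ` against the weights given by the coefficients of `A`. -/
noncomputable def wsum (A : ℝ≥0∞⟦X⟧) (φ : ℕ → ℝ≥0∞) : ℝ≥0∞ := ∑' n, coeff n A * φ n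

theorem tsum_sum_antidiagonal (f : ℕ × ℕ → ℝ≥0∞) :
    ∑' n, ∑ x ∈ antidiagonal n, f x = ∑' a, ∑' b, f (a, b) := by
  rw [← ENNReal.tsum_prod (f := fun a b => f (a, b)),
    ← Finset.HasAntidiagonal.sigmaAntidiagonalEquivProd.tsum_eq, ENNReal.tsum_sigma']
  refine tsum_congr fun n => ?_
  rw [← Finset.tsum_subtype]
  rfl

/-- Multiplying series convolves weights, so for probability laws this is the expectation of a
function of a sum of two independent variables. It lets the whole argument stay at the level of
series, without constructing random walks. -/
theorem wsum_mul (A B : ℝ≥0∞⟦X⟧) (φ : ℕ → ℝ≥0∞) :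
    wsum (A * B) φ = wsum A fun a => wsum B fun b => φ (a + b) := by
  simp only [wsum, coeff_mul, Finset.sum_mul]
  calc ∑' n, ∑ x ∈ antidiagonal n, coeff x.1 A * coeff x.2 B * φ n
      = ∑' n, ∑ x ∈ antidiagonal n, coeff x.1 A * coeff x.2 B * φ (x.1 + x.2) := by
        refine tsum_congr fun n => Finset.sum_congr rfl fun x hx => ?_
        rw [mem_antidiagonal.1 hx]
    _ = ∑' a, ∑' b, coeff a A * coeff b B * φ (a + b) :=
        tsum_sum_antidiagonal fun x => coeff x.1 A * coeff x.2 B * φ (x.1 + x.2)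
    _ = _ := by simp only [← ENNReal.tsum_mul_left, mul_assoc]

theorem wsum_add (A B : ℝ≥0∞⟦X⟧) (φ : ℕ → ℝ≥0∞) : wsum (A + B) φ = wsum A φ + wsum B φ := by
  simp only [wsum, map_add, add_mul, ENNReal.tsum_add]

theorem wsum_sum {ι : Type*} (s : Finset ι) (A : ι → ℝ≥0∞⟦X⟧) (φ : ℕ → ℝ≥0∞) :
    wsum (∑ i ∈ s, A i) φ = ∑ i ∈ s, wsum (A i) φ := by
  classical
  induction s using Finset.induction_on with
  | empty => simp [wsum]
  | insert a s ha ih => rw [Finset.sum_insert ha, Finset.sum_insert ha, wsum_add, ih]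

theorem wsum_C_mul (c : ℝ≥0∞) (A : ℝ≥0∞⟦X⟧) (φ : ℕ → ℝ≥0∞) :
    wsum (C c * A) φ = c * wsum A φ := by
  simp only [wsum, coeff_C_mul, ← ENNReal.tsum_mul_left, mul_assoc]

theorem wsum_X_pow (t : ℕ) (φ : ℕ → ℝ≥0∞) : wsum (X ^ t) φ = φ t := by
  simp only [wsum, coeff_X_pow, ite_mul, one_mul, zero_mul]
  exact (tsum_eq_single t fun n hn => by simp [hn]).trans (by simp)

theorem wsum_one (φ : ℕ → ℝ≥0∞) : wsum 1 φ = φ 0 := by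
  simpa using wsum_X_pow 0 φ

theorem wsum_X (φ : ℕ → ℝ≥0∞) : wsum X φ = φ 1 := by
  simpa using wsum_X_pow 1 φ

theorem wsum_X_pow_mul (t : ℕ) (A : ℝ≥0∞⟦X⟧) (φ : ℕ → ℝ≥0∞) :
    wsum (X ^ t * A) φ = wsum A fun n => φ (t + n) := by
  rw [wsum_mul, wsum_X_pow]

theorem wsum_mono (A : ℝ≥0∞⟦X⟧) {φ ψ : ℕ → ℝ≥0∞} (h : ∀ n, coeff n A ≠ 0 → φ n ≤ ψ n) :
    wsum A φ ≤ wsum A ψ := by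
  refine ENNReal.tsum_le_tsum fun n => ?_
  by_cases h0 : coeff n A = 0
  · simp [h0]
  · gcongr; exact h n h0

theorem wsum_mono_left {A B : ℝ≥0∞⟦X⟧} (h : ∀ n, coeff n A ≤ coeff n B) (φ : ℕ → ℝ≥0∞) :
    wsum A φ ≤ wsum B φ :=
  ENNReal.tsum_le_tsum fun n => by gcongr; exact h n

theorem wsum_add_right (A : ℝ≥0∞⟦X⟧) (φ ψ : ℕ → ℝ≥0∞) :
    wsum A (fun n => φ n + ψ n) = wsum A φ + wsum A ψ := by
  simp only [wsum, mul_add, ENNReal.tsum_add]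

theorem wsum_mul_left (A : ℝ≥0∞⟦X⟧) (c : ℝ≥0∞) (φ : ℕ → ℝ≥0∞) :
    wsum A (fun n => c * φ n) = c * wsum A φ := by
  simp only [wsum, ← ENNReal.tsum_mul_left, mul_left_comm]

theorem wsum_mul_right (A : ℝ≥0∞⟦X⟧) (c : ℝ≥0∞) (φ : ℕ → ℝ≥0∞) :
    wsum A (fun n => φ n * c) = wsum A φ * c := by
  simp only [mul_comm _ c, wsum_mul_left]

theorem wsum_const (A : ℝ≥0∞⟦X⟧) (c : ℝ≥0∞) :
    wsum A (fun _ => c) = wsum A 1 * c := by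
  rw [← wsum_mul_right]; simp

theorem wsum_finset_sum_right {ι : Type*} (s : Finset ι) (A : ℝ≥0∞⟦X⟧) (φ : ι → ℕ → ℝ≥0∞) :
    wsum A (fun n => ∑ i ∈ s, φ i n) = ∑ i ∈ s, wsum A (φ i) := by
  classical
  induction s using Finset.induction_on with
  | empty => simp [wsum]
  | insert a s ha ih => simp only [Finset.sum_insert ha, wsum_add_right, ih]

theorem wsum_comm (A B : ℝ≥0∞⟦X⟧) (φ : ℕ → ℕ → ℝ≥0∞) :
    (wsum A fun a => wsum B fun b => φ a b) = wsum B fun b => wsum A fun a => φ a b := by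
  simp only [wsum, ← ENNReal.tsum_mul_left]
  rw [ENNReal.tsum_comm]
  simp only [mul_left_comm]

theorem wsum_mass_mul (A B : ℝ≥0∞⟦X⟧) : wsum (A * B) 1 = wsum A 1 * wsum B 1 := by
  rw [wsum_mul]
  exact wsum_const A (wsum B 1)

theorem wsum_mass_pow (A : ℝ≥0∞⟦X⟧) (k : ℕ) : wsum (A ^ k) 1 = wsum A 1 ^ k := by
  induction k with
  | zero => simp [wsum_one]
  | succ k ih => rw [pow_succ, pow_succ, wsum_mass_mul, ih]

theorem coeff_eq_wsum (A : ℝ≥0∞⟦X⟧) (n : ℕ) :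
    coeff n A = wsum A fun m => if m = n then 1 else 0 := by
  simp only [wsum, mul_ite, mul_one, mul_zero]
  exact ((tsum_eq_single n fun m hm => by simp [hm]).trans (by simp)).symm

theorem coeff_le_mass (A : ℝ≥0∞⟦X⟧) (n : ℕ) : coeff n A ≤ wsum A 1 := by
  rw [coeff_eq_wsum]
  exact wsum_mono A fun m _ => by split_ifs <;> simp

/-- If the coefficients of `B` are bounded by `c`, those of `A * B` are bounded by `c` times the
sum of the coefficients of `A`. -/
theorem coeff_mul_le (A B : ℝ≥0∞⟦X⟧) {c : ℝ≥0∞} (h : ∀ n, coeff n B ≤ c) (n : ℕ) :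
    coeff n (A * B) ≤ wsum A 1 * c := by
  rw [coeff_eq_wsum, wsum_mul, ← wsum_const]
  refine wsum_mono A fun a _ => ?_
  by_cases ha : a ≤ n
  · refine le_trans (le_of_eq ?_) (h (n - a))
    rw [coeff_eq_wsum]
    congr 1; ext b; congr 1
    exact propext (by omega)
  · refine le_trans (le_of_eq ?_) (zero_le)
    have : ∀ b, ¬ a + b = n := by intro b; omega
    simp [this, wsum]

/-- The composition `A ∘ S` of power series with nonnegative coefficients. -/
noncomputable def comp (A S : ℝ≥0∞⟦X⟧) : ℝ≥0∞⟦X⟧ := mk fun n => wsum A fun N => coeff n (S ^ N)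

theorem coeff_comp (A S : ℝ≥0∞⟦X⟧) (n : ℕ) :
    coeff n (comp A S) = wsum A fun N => coeff n (S ^ N) := coeff_mk _ _

/-- Comes down to `S^(a+b) = S^a S^b`. Since all sums are taken in `ℝ≥0∞`, no condition on the
constant term of `S` is needed. -/
theorem comp_mul (A B S : ℝ≥0∞⟦X⟧) : comp (A * B) S = comp A S * comp B S := by
  ext n
  simp only [coeff_comp, coeff_mul, wsum_mul, pow_add, wsum_finset_sum_right, wsum_mul_left,
    wsum_mul_right]

theorem comp_X (S : ℝ≥0∞⟦X⟧) : comp X S = S := by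
  ext n; simp [coeff_comp, wsum_X]

theorem comp_one (S : ℝ≥0∞⟦X⟧) : comp 1 S = 1 := by
  ext n; simp [coeff_comp, wsum_one]

theorem comp_pow (A S : ℝ≥0∞⟦X⟧) (k : ℕ) : comp (A ^ k) S = comp A S ^ k := by
  induction k with
  | zero => simp [comp_one]
  | succ k ih => rw [pow_succ, pow_succ, comp_mul, ih]

/-- All exponents of `A` are congruent to `r` modulo `d`. -/
def SuppMod (d : ℕ) (r : ZMod d) (A : ℝ≥0∞⟦X⟧) : Prop := ∀ n, coeff n A ≠ 0 → (n : ZMod d) = r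

theorem SuppMod.mul {d : ℕ} {r s : ZMod d} {A B : ℝ≥0∞⟦X⟧} (hA : SuppMod d r A)
    (hB : SuppMod d s B) : SuppMod d (r + s) (A * B) := by
  intro n hn
  rw [coeff_mul] at hn
  obtain ⟨x, hx, h⟩ := Finset.exists_ne_zero_of_sum_ne_zero hn
  rw [← mem_antidiagonal.1 hx, Nat.cast_add, hA _ (left_ne_zero_of_mul h),
    hB _ (right_ne_zero_of_mul h)]

theorem suppMod_X_pow (d t : ℕ) : SuppMod d t (X ^ t) := by
  intro n hn
  rw [coeff_X_pow] at hn
  split_ifs at hn with h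
  · rw [h]
  · exact absurd rfl hn

theorem SuppMod.pow {d : ℕ} {r : ZMod d} {A : ℝ≥0∞⟦X⟧} (hA : SuppMod d r A) (k : ℕ) :
    SuppMod d (k * r) (A ^ k) := by
  induction k with
  | zero => simpa using suppMod_X_pow d 0
  | succ k ih => rw [pow_succ, Nat.cast_succ, add_mul, one_mul]; exact ih.mul hA

theorem SuppMod.mono {d : ℕ} {r : ZMod d} {A B : ℝ≥0∞⟦X⟧} (hA : SuppMod d r A)
    (h : ∀ n, coeff n B ≤ coeff n A) : SuppMod d r B :=
  fun n hn => hA n fun h0 => hn (le_antisymm (h0 ▸ h n) zero_le)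

/-- First moment of a power: `∑ n, n [X^n] A^k = k A(1)^(k-1) A'(1)`. -/
theorem wsum_pow_id (A : ℝ≥0∞⟦X⟧) (k : ℕ) :
    wsum (A ^ (k + 1)) (fun n => (n : ℝ≥0∞)) =
      (k + 1) * (wsum A 1) ^ k * wsum A (fun n => (n : ℝ≥0∞)) := by
  induction k with
  | zero => simp
  | succ k ih =>
    rw [pow_succ, wsum_mul]
    simp only [Nat.cast_add, wsum_add_right, wsum_const, wsum_mul_left, ih, wsum_mass_pow]
    push_cast
    ring

end GaltonWatson

/-! ### Binomial coefficients and binomial averages. -/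

namespace GaltonWatson
open PowerSeries Finset.HasAntidiagonal

/-- The quotient of the two sides is monotone in `t`: the ratio of consecutive central coefficients
is `2(2t+1)/(t+1)`, and `(2t+1)(2t+3) ≤ 4(t+1)^2`. This is a Wallis bound without Stirling's
formula; the next lemma is its counterpart from below. -/
theorem centralBinom_sq_mul_le (t : ℕ) : t.centralBinom ^ 2 * (2 * t + 1) ≤ 16 ^ t := by
  induction t with
  | zero => simp
  | succ t ih =>
    have h := Nat.succ_mul_centralBinom_succ t
    refine Nat.le_of_mul_le_mul_left ?_ (show 0 < (t + 1) ^ 2 by positivity)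
    calc (t + 1) ^ 2 * ((t + 1).centralBinom ^ 2 * (2 * (t + 1) + 1))
        = ((t + 1) * (t + 1).centralBinom) ^ 2 * (2 * t + 3) := by ring
      _ = (t.centralBinom ^ 2 * (2 * t + 1)) * (4 * (2 * t + 1) * (2 * t + 3)) := by rw [h]; ring
      _ ≤ 16 ^ t * (4 * (2 * t + 1) * (2 * t + 3)) := by gcongr
      _ ≤ 16 ^ t * (16 * (t + 1) ^ 2) := Nat.mul_le_mul_left _ (by nlinarith)
      _ = (t + 1) ^ 2 * 16 ^ (t + 1) := by ring

theorem le_centralBinom_sq_mul (t : ℕ) (ht : 1 ≤ t) : 16 ^ t ≤ t.centralBinom ^ 2 * (4 * t) := by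
  induction t, ht using Nat.le_induction with
  | base => simp [Nat.centralBinom]
  | succ t ht ih =>
    have h := Nat.succ_mul_centralBinom_succ t
    refine Nat.le_of_mul_le_mul_left ?_ (show 0 < t * (t + 1) by positivity)
    calc t * (t + 1) * 16 ^ (t + 1) = 16 ^ t * (16 * (t * (t + 1))) := by ring
      _ ≤ t.centralBinom ^ 2 * (4 * t) * (16 * (t * (t + 1))) := by gcongr
      _ = t.centralBinom ^ 2 * (4 * (t * (t + 1))) * (16 * t) := by ring
      _ ≤ t.centralBinom ^ 2 * ((2 * t + 1) ^ 2) * (16 * t) := by gcongr; nlinarith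
      _ = 4 * t * (2 * (2 * t + 1) * t.centralBinom) ^ 2 := by ring
      _ = t * (t + 1) * ((t + 1).centralBinom ^ 2 * (4 * (t + 1))) := by rw [← h]; ring

theorem choose_sq_mul_le (l i : ℕ) : l.choose i ^ 2 * (l + 1) ≤ 4 ^ l := by
  rcases Nat.even_or_odd' l with ⟨t, rfl | rfl⟩
  · calc (2 * t).choose i ^ 2 * (2 * t + 1) ≤ t.centralBinom ^ 2 * (2 * t + 1) := by
          gcongr; exact Nat.choose_le_centralBinom i t
      _ ≤ 16 ^ t := centralBinom_sq_mul_le t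
      _ = 4 ^ (2 * t) := by rw [pow_mul]; norm_num
  · have h1 : 2 * (2 * t + 1).choose i ≤ (t + 1).centralBinom := by
      have h := Nat.choose_le_middle i (2 * t + 1)
      rw [show (2 * t + 1) / 2 = t by omega] at h
      rw [Nat.centralBinom, show 2 * (t + 1) = (2 * t + 1) + 1 by ring, Nat.choose_succ_succ',
        ← Nat.choose_symm_half t]
      have := Nat.choose_symm_half t
      omega
    have h2 := centralBinom_sq_mul_le (t + 1)
    have h3 : (2 * (2 * t + 1).choose i) ^ 2 * (2 * (t + 1) + 1) ≤ 16 ^ (t + 1) :=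
      le_trans (by gcongr) h2
    have h4 : (4 : ℕ) ^ (2 * t + 1) = 4 * 16 ^ t := by rw [pow_succ, pow_mul]; norm_num; ring
    rw [h4]
    have h5 : (16 : ℕ) ^ (t + 1) = 16 * 16 ^ t := by ring
    nlinarith [sq_nonneg ((2 * t + 1).choose i)]

theorem choose_le_two_pow_div_sqrt (l i : ℕ) : (l.choose i : ℝ) ≤ 2 ^ l / √(l + 1) := by
  have h : ((l.choose i : ℝ)) ^ 2 * (l + 1) ≤ 4 ^ l := by exact_mod_cast choose_sq_mul_le l i
  rw [le_div_iff₀ (by positivity)]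
  refine (sq_le_sq₀ (by positivity) (by positivity)).1 ?_
  rw [mul_pow, Real.sq_sqrt (by positivity), ← pow_mul, mul_comm l 2, pow_mul]
  norm_num
  exact h

theorem exp_neg_two_mul_le {x : ℝ} (h0 : 0 ≤ x) (h1 : x ≤ 1 / 2) : Real.exp (-(2 * x)) ≤ 1 - x := by
  rw [Real.exp_neg]
  refine inv_le_of_inv_le₀ (by linarith) ?_
  have := Real.add_one_le_exp (2 * x)
  refine le_trans ?_ this
  rw [inv_le_iff_one_le_mul₀ (by linarith)]
  nlinarith

/-- Moving from `t + r` to `t + r + 1` multiplies the coefficient by `(t-r)/(t+r+1)`, which is at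
least `1 - 2s/t` for `r < s`. The assumption `4s ≤ t` puts `2s/t` in the range where `1 - x ≥
exp(-2x)`. -/
theorem centralBinom_mul_exp_le_choose (t s : ℕ) (ht : 1 ≤ t) (hs : 4 * s ≤ t) :
    t.centralBinom * Real.exp (-(4 * s ^ 2 / t)) ≤ (2 * t).choose (t + s) := by
  have ht' : (0 : ℝ) < t := by positivity
  have hs' : 4 * (s : ℝ) ≤ t := by exact_mod_cast hs
  have key : ∀ r ≤ s, t.centralBinom * (1 - 2 * s / t : ℝ) ^ r ≤ (2 * t).choose (t + r) := by
    intro r hr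
    induction r with
    | zero => simp [Nat.centralBinom]
    | succ r ih =>
      have h1 := ih (by omega)
      have h2 : ((2 * t).choose (t + r + 1) : ℝ) * (t + r + 1) = (2 * t).choose (t + r) * (t - r) := by
        have := Nat.choose_succ_right_eq (2 * t) (t + r)
        rw [show 2 * t - (t + r) = t - r by omega] at this
        have h := congrArg (Nat.cast (R := ℝ)) this
        rw [Nat.cast_mul, Nat.cast_mul, Nat.cast_sub (by omega)] at h
        push_cast at h
        exact h
      have h3 : (1 - 2 * s / t : ℝ) * (t + r + 1) ≤ t - r := by
        have hr' : (r : ℝ) + 1 ≤ s := by exact_mod_cast hr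
        have h4 : (2 * s / t : ℝ) * (t + r + 1) ≥ 2 * s := by
          rw [ge_iff_le, div_mul_eq_mul_div, le_div_iff₀ ht']
          gcongr; nlinarith [Nat.cast_nonneg (α := ℝ) r]
        nlinarith
      have h5 : (0 : ℝ) ≤ 1 - 2 * s / t := by
        rw [sub_nonneg, div_le_one ht']; linarith [Nat.cast_nonneg (α := ℝ) s]
      refine le_of_mul_le_mul_right ?_ (show (0 : ℝ) < t + r + 1 by positivity)
      calc t.centralBinom * (1 - 2 * s / t : ℝ) ^ (r + 1) * (t + r + 1)
          = (t.centralBinom * (1 - 2 * s / t : ℝ) ^ r) * ((1 - 2 * s / t : ℝ) * (t + r + 1)) := by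
            ring
        _ ≤ (2 * t).choose (t + r) * (t - r) := by
            gcongr
        _ = _ := by rw [← h2]; norm_num [add_assoc]
  refine le_trans ?_ (key s le_rfl)
  gcongr
  have h6 := exp_neg_two_mul_le (x := 2 * s / t) (by positivity) (by rw [div_le_iff₀ ht']; linarith)
  calc Real.exp (-(4 * s ^ 2 / t)) = Real.exp (-(2 * (2 * s / t))) ^ s := by
        rw [← Real.exp_nat_mul]; congr 1; ring
    _ ≤ _ := by gcongr

/-- Local lower bound for binomial coefficients near the centre. -/
theorem exists_choose_ge (K : ℝ) (hK : 0 ≤ K) : ∃ c > 0, ∃ L : ℕ, ∀ l ≥ L, ∀ i : ℕ,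
    |(i : ℝ) - l / 2| ≤ K * √l → c * 2 ^ l / √l ≤ (l.choose i : ℝ) := by
  -- With `t = l / 2` rounded down, `K + 1` absorbs the rounding of the centre. The exponent comes
  -- from `4 s^2 / t` with `s ≤ (K+1)√l` and `l ≤ 3t`, the factor `1/4` from comparing the central
  -- coefficient with `2^l / √l`, and the threshold ensures `4s ≤ t`.
  refine ⟨Real.exp (-(12 * (K + 1) ^ 2)) / 4, by positivity, ⌈(16 * (K + 1)) ^ 2⌉₊, ?_⟩
  intro l hl i hi
  have hl1 : (16 * (K + 1)) ^ 2 ≤ (l : ℝ) := (Nat.le_ceil _).trans (by exact_mod_cast hl)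
  have hsq : √(l : ℝ) ^ 2 = l := Real.sq_sqrt (by positivity)
  have hl2 : 16 * (K + 1) ≤ √(l : ℝ) := Real.le_sqrt_of_sq_le hl1
  have hl3 : (256 : ℝ) ≤ l := by nlinarith
  have hl4 : 256 ≤ l := by exact_mod_cast hl3
  set t := l / 2 with ht
  have ht1 : (t : ℝ) ≤ l / 2 := by
    rw [le_div_iff₀ (by norm_num)]; exact_mod_cast (by omega : t * 2 ≤ l)
  have ht2 : (l : ℝ) / 2 ≤ t + 1 / 2 := by
    have : (l : ℝ) ≤ 2 * t + 1 := by exact_mod_cast (by omega : l ≤ 2 * t + 1)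
    linarith
  obtain ⟨s, hs, hsi⟩ : ∃ s : ℕ, (s : ℝ) = |(i : ℝ) - t| ∧ (i = t + s ∨ i + s = t) := by
    rcases le_total t i with h | h
    · refine ⟨i - t, ?_, Or.inl (by omega)⟩
      rw [Nat.cast_sub h, abs_of_nonneg]
      rw [sub_nonneg]; exact_mod_cast h
    · refine ⟨t - i, ?_, Or.inr (by omega)⟩
      rw [Nat.cast_sub h, abs_of_nonpos, neg_sub]
      rw [sub_nonpos]; exact_mod_cast h
  have hs1 : (s : ℝ) ≤ (K + 1) * √l := by
    have : |(i : ℝ) - t| ≤ |(i : ℝ) - l / 2| + 1 / 2 := by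
      rw [abs_le]; constructor <;> cases abs_cases ((i : ℝ) - l / 2) <;> linarith
    rw [hs]; nlinarith
  have hs2 : 4 * s ≤ t := by
    have : 4 * (s : ℝ) ≤ t := by nlinarith
    exact_mod_cast this
  have hc : (2 * t).choose (t + s) ≤ l.choose i := by
    rcases hsi with rfl | h
    · exact Nat.choose_le_choose _ (by omega)
    · refine le_trans (le_of_eq ?_) (Nat.choose_le_choose i (show 2 * t ≤ l by omega))
      rw [← Nat.choose_symm (by omega)]; congr 1; omega
  have ht3 : 1 ≤ t := by omega
  have hcb : 2 ^ l / (4 * √l) ≤ (t.centralBinom : ℝ) := by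
    have h1 : (16 : ℝ) ^ t ≤ t.centralBinom ^ 2 * (4 * t) := by
      exact_mod_cast le_centralBinom_sq_mul t ht3
    rw [div_le_iff₀ (by positivity)]
    refine (sq_le_sq₀ (by positivity) (by positivity)).1 ?_
    have h2 : ((2 : ℝ) ^ l) ^ 2 ≤ 4 * 16 ^ t := by
      rw [← pow_mul, show (16 : ℝ) = 2 ^ 4 by norm_num, show (4 : ℝ) = 2 ^ 2 by norm_num,
        ← pow_mul, ← pow_add]
      exact pow_le_pow_right₀ (by norm_num) (by omega)
    rw [mul_pow, mul_pow, hsq]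
    nlinarith [sq_nonneg (t.centralBinom : ℝ)]
  have h4 := centralBinom_mul_exp_le_choose t s ht3 hs2
  have ht' : (0 : ℝ) < t := by positivity
  have h5 : 4 * (s : ℝ) ^ 2 / t ≤ 12 * (K + 1) ^ 2 := by
    rw [div_le_iff₀ ht']
    have : (s : ℝ) ^ 2 ≤ ((K + 1) * √l) ^ 2 := by gcongr
    rw [mul_pow, hsq] at this
    have h6 : (l : ℝ) ≤ 3 * t := by exact_mod_cast (by omega : l ≤ 3 * t)
    nlinarith [sq_nonneg (K + 1)]
  calc Real.exp (-(12 * (K + 1) ^ 2)) / 4 * 2 ^ l / √l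
      = 2 ^ l / (4 * √l) * Real.exp (-(12 * (K + 1) ^ 2)) := by
        field_simp
    _ ≤ t.centralBinom * Real.exp (-(4 * s ^ 2 / t)) := by gcongr
    _ ≤ (2 * t).choose (t + s) := h4
    _ ≤ _ := by exact_mod_cast hc

/-- The expectation of `1 / (L + 1)` for a binomial variable `L`. -/
theorem sum_binomial_mul_inv_le (M : ℕ) (a b : ℝ≥0∞) (hab : a + b = 1) :
    (∑ l ∈ Finset.range (M + 1), (M.choose l : ℝ≥0∞) * a ^ l * b ^ (M - l) * ((l : ℝ≥0∞) + 1)⁻¹) *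
      ((M + 1) * a) ≤ 1 := by
  have h : (a + b) ^ (M + 1) = 1 := by rw [hab, one_pow]
  refine le_trans ?_ h.le
  -- Since `(M+1) C(M,l) = (l+1) C(M+1,l+1)`, the left side is the expansion of `(a+b)^(M+1)`
  -- without its first term.
  rw [add_pow, Finset.sum_mul, Finset.sum_range_succ' _ (M + 1)]
  refine le_trans (Finset.sum_le_sum fun l hl => le_of_eq ?_) le_self_add
  have h1 : ((M : ℝ≥0∞) + 1) * M.choose l = (M + 1).choose (l + 1) * (l + 1) := by
    exact_mod_cast Nat.add_one_mul_choose_eq M l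
  calc (M.choose l : ℝ≥0∞) * a ^ l * b ^ (M - l) * ((l : ℝ≥0∞) + 1)⁻¹ * ((M + 1) * a)
      = ((M + 1) * M.choose l) * ((l : ℝ≥0∞) + 1)⁻¹ * (a ^ (l + 1) * b ^ (M - l)) := by ring
    _ = (M + 1).choose (l + 1) * (((l : ℝ≥0∞) + 1) * ((l : ℝ≥0∞) + 1)⁻¹) *
        (a ^ (l + 1) * b ^ (M - l)) := by rw [h1]; ring
    _ = _ := by
      rw [ENNReal.mul_inv_cancel (by simp) (by finiteness), Nat.add_sub_add_right]; ring

theorem wsum_X_pow_add_one_pow (d l : ℕ) (φ : ℕ → ℝ≥0∞) :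
    wsum ((X ^ d + 1) ^ l) φ = ∑ i ∈ Finset.range (l + 1), (l.choose i : ℝ≥0∞) * φ (d * i) := by
  rw [add_pow, wsum_sum]
  refine Finset.sum_congr rfl fun i _ => ?_
  rw [one_pow, mul_one, ← pow_mul, mul_comm, show ((l.choose i : ℕ) : ℝ≥0∞⟦X⟧) =
    C (l.choose i : ℝ≥0∞) from (map_natCast C _).symm, wsum_C_mul, wsum_X_pow]

theorem coeff_X_pow_add_one_pow_le (d l t : ℕ) (hd : 1 ≤ d) :
    coeff t ((X ^ d + 1 : ℝ≥0∞⟦X⟧) ^ l) ≤ 2 ^ l * ENNReal.ofReal (1 / √(l + 1)) := by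
  have h2 : ∀ i, (l.choose i : ℝ≥0∞) ≤ 2 ^ l * ENNReal.ofReal (1 / √(l + 1)) := by
    intro i
    have := ENNReal.ofReal_le_ofReal (choose_le_two_pow_div_sqrt l i)
    rw [ENNReal.ofReal_natCast, div_eq_mul_one_div, ENNReal.ofReal_mul (by positivity),
      ENNReal.ofReal_pow (by norm_num)] at this
    simpa using this
  rw [coeff_eq_wsum, wsum_X_pow_add_one_pow]
  by_cases h : ∃ i ∈ Finset.range (l + 1), d * i = t
  · obtain ⟨i, hi, rfl⟩ := h
    rw [Finset.sum_eq_single_of_mem i hi]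
    · simpa using h2 i
    · intro j _ hj
      rw [if_neg, mul_zero]
      intro h
      exact hj (Nat.eq_of_mul_eq_mul_left hd h)
  · push Not at h
    rw [Finset.sum_eq_zero fun i hi => by rw [if_neg (h i hi), mul_zero]]
    exact zero_le

/-- Jensen's inequality for the square against the binomial weights. -/
theorem sq_le_sum_choose (l d : ℕ) (u : ℝ) :
    2 ^ l * ENNReal.ofReal ((u + d * l / 2) ^ 2) ≤
      ∑ i ∈ Finset.range (l + 1), (l.choose i : ℝ≥0∞) * ENNReal.ofReal ((u + d * i) ^ 2) := by
  have key : 2 ^ l * (u + d * l / 2) ^ 2 ≤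
      ∑ i ∈ Finset.range (l + 1), (l.choose i : ℝ) * (u + d * i) ^ 2 := by
    have h1 : ∑ i ∈ Finset.range (l + 1), (l.choose i : ℝ) * (u + d * i) ^ 2 =
        ∑ i ∈ Finset.range (l + 1), (l.choose i : ℝ) * (u + d * (l - i)) ^ 2 := by
      rw [← Finset.sum_range_reflect]
      refine Finset.sum_congr rfl fun i hi => ?_
      have hi' : i ≤ l := Nat.lt_succ_iff.1 (Finset.mem_range.1 hi)
      rw [show l + 1 - 1 - i = l - i by omega, Nat.choose_symm hi', Nat.cast_sub hi']
    have h2 : (2 : ℝ) ^ l = ∑ i ∈ Finset.range (l + 1), (l.choose i : ℝ) := by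
      exact_mod_cast (Nat.sum_range_choose l).symm
    have h3 : 2 * (2 ^ l * (u + d * l / 2) ^ 2) ≤
        ∑ i ∈ Finset.range (l + 1), (l.choose i : ℝ) * (u + d * i) ^ 2 +
        ∑ i ∈ Finset.range (l + 1), (l.choose i : ℝ) * (u + d * (l - i)) ^ 2 := by
      rw [h2, Finset.sum_mul, Finset.mul_sum, ← Finset.sum_add_distrib]
      refine Finset.sum_le_sum fun i _ => ?_
      have : 2 * (u + d * l / 2) ^ 2 ≤ (u + d * i) ^ 2 + (u + d * (l - i)) ^ 2 := by
        nlinarith [sq_nonneg (d * (i - l / 2 : ℝ))]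
      calc (2 : ℝ) * (l.choose i * (u + d * l / 2) ^ 2)
          = l.choose i * (2 * (u + d * l / 2) ^ 2) := by ring
        _ ≤ l.choose i * ((u + d * i) ^ 2 + (u + d * (l - i)) ^ 2) := by gcongr
        _ = _ := by ring
    linarith
  have := ENNReal.ofReal_le_ofReal key
  rw [ENNReal.ofReal_mul (by positivity), ENNReal.ofReal_pow (by norm_num),
    ENNReal.ofReal_sum_of_nonneg (fun i _ => by positivity)] at this
  simpa [ENNReal.ofReal_mul] using this

end GaltonWatson

/-! ### Critical offspring laws and upper bounds for the atoms of their convolution powers. -/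

namespace GaltonWatson
open PowerSeries Finset.HasAntidiagonal

/-- `G` is the generating function of a nondegenerate offspring distribution with mean one and
finite second moment. -/
structure IsCritical (G : ℝ≥0∞⟦X⟧) : Prop where
  mass : wsum G 1 = 1
  mean : wsum G (fun n => (n : ℝ≥0∞)) = 1
  second : wsum G (fun n => (n : ℝ≥0∞) ^ 2) ≠ ⊤
  zero : coeff 0 G ≠ 0
  large : ∃ r ≥ 2, coeff r G ≠ 0

/-- The variance of the distribution with generating function `G` and mean one. -/
noncomputable def var (G : ℝ≥0∞⟦X⟧) : ℝ≥0∞ := wsum G fun n => ENNReal.ofReal (((n : ℝ) - 1) ^ 2)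

/-- The expanded square, with the cross term kept on the left so that moments can be compared in
`ℝ≥0∞` without subtraction. -/
theorem ofReal_sub_sq_add (j m : ℕ) :
    ENNReal.ofReal (((j : ℝ) - m) ^ 2) + 2 * m * j = (j : ℝ≥0∞) ^ 2 + (m : ℝ≥0∞) ^ 2 := by
  have h : (2 * m * j : ℝ≥0∞) = ENNReal.ofReal (2 * m * j) := by
    rw [ENNReal.ofReal_mul (by positivity), ENNReal.ofReal_mul (by positivity)]; simp
  have h2 : (j : ℝ≥0∞) ^ 2 + (m : ℝ≥0∞) ^ 2 = ENNReal.ofReal ((j : ℝ) ^ 2 + (m : ℝ) ^ 2) := by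
    rw [ENNReal.ofReal_add (by positivity) (by positivity), ENNReal.ofReal_pow (by positivity),
      ENNReal.ofReal_pow (by positivity)]; simp
  rw [h, h2, ← ENNReal.ofReal_add (by positivity) (by positivity)]
  congr 1; ring

namespace IsCritical
variable {G : ℝ≥0∞⟦X⟧} (hG : IsCritical G)
include hG

theorem pow_mass (m : ℕ) : wsum (G ^ m) 1 = 1 := by
  rw [wsum_mass_pow, hG.mass, one_pow]

theorem pow_mean (m : ℕ) : wsum (G ^ m) (fun n => (n : ℝ≥0∞)) = m := by
  cases m with
  | zero => simp [wsum_one]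
  | succ m => rw [wsum_pow_id, hG.mass, hG.mean]; simp

theorem pow_second (m : ℕ) : wsum (G ^ m) (fun n => (n : ℝ≥0∞) ^ 2) + m =
    m * wsum G (fun n => (n : ℝ≥0∞) ^ 2) + m ^ 2 := by
  induction m with
  | zero => simp [wsum_one]
  | succ m ih =>
    have h : ∀ a b : ℕ, ((a + b : ℕ) : ℝ≥0∞) ^ 2 = (a : ℝ≥0∞) ^ 2 + (2 * a) * b + b ^ 2 := by
      intro a b; push_cast; ring
    rw [pow_succ, wsum_mul]
    simp only [h, wsum_add_right, wsum_const, wsum_mul_left, hG.mass, hG.mean, one_mul, mul_one,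
      hG.pow_mean, hG.pow_mass]
    calc wsum (G ^ m) (fun n => (n : ℝ≥0∞) ^ 2) + 2 * m + wsum G (fun n => (n : ℝ≥0∞) ^ 2) +
          (m + 1 : ℕ) = (wsum (G ^ m) (fun n => (n : ℝ≥0∞) ^ 2) + m) + 2 * m +
            wsum G (fun n => (n : ℝ≥0∞) ^ 2) + 1 := by push_cast; ring
      _ = _ := by rw [ih]; push_cast; ring

theorem var_add_one : var G + 1 = wsum G (fun n => (n : ℝ≥0∞) ^ 2) := by
  have h := congrArg (wsum G) (funext fun n => ofReal_sub_sq_add n 1)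
  simp only [wsum_add_right, wsum_mul_left, hG.mean, wsum_const, hG.mass] at h
  have h3 : var G + 1 + 1 = wsum G (fun n => (n : ℝ≥0∞) ^ 2) + 1 := by
    rw [add_assoc, one_add_one_eq_two]
    simpa [var] using h
  exact (ENNReal.add_left_inj ENNReal.one_ne_top).1 h3

theorem var_ne_top : var G ≠ ⊤ := by
  have h := hG.second
  rw [← hG.var_add_one] at h
  exact fun h' => h (by simp [h'])

theorem pow_var (m : ℕ) :
    wsum (G ^ m) (fun n => ENNReal.ofReal (((n : ℝ) - m) ^ 2)) = m * var G := by
  have h := congrArg (wsum (G ^ m)) (funext fun n => ofReal_sub_sq_add n m)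
  simp only [wsum_add_right, wsum_mul_left, hG.pow_mean, wsum_const, hG.pow_mass, one_mul] at h
  have h2 := hG.pow_second m
  rw [← hG.var_add_one] at h2
  have h3 : wsum (G ^ m) (fun n => ENNReal.ofReal (((n : ℝ) - m) ^ 2)) + (2 * m * m + m) =
      m * var G + (2 * m * m + m) := by
    rw [← add_assoc, h, add_right_comm, h2]; ring
  exact (ENNReal.add_left_inj (by finiteness)).1 h3

theorem coeff_pow_le_one (m j : ℕ) : coeff j (G ^ m) ≤ 1 :=
  (coeff_le_mass _ _).trans (hG.pow_mass m).le

end IsCritical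

theorem coeff_pow_mul_ne_zero {A B : ℝ≥0∞⟦X⟧} {a b : ℕ} (ha : coeff a A ≠ 0) (hb : coeff b B ≠ 0) :
    coeff (a + b) (A * B) ≠ 0 := by
  rw [coeff_mul]
  refine ne_of_gt (lt_of_lt_of_le (pos_iff_ne_zero.2 (mul_ne_zero ha hb))
    (Finset.single_le_sum (f := fun x => coeff x.1 A * coeff x.2 B) (fun _ _ => zero_le)
      (mem_antidiagonal.2 (rfl : (a, b).1 + (a, b).2 = a + b))))

theorem coeff_pow_ne_zero {A : ℝ≥0∞⟦X⟧} {a : ℕ} (ha : coeff a A ≠ 0) (q : ℕ) :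
    coeff (q * a) (A ^ q) ≠ 0 := by
  induction q with
  | zero => simp
  | succ q ih => rw [pow_succ, add_mul, one_mul]; exact coeff_pow_mul_ne_zero ih ha

/-- The span `d` of the offspring distribution is a difference of two atoms of some convolution
power. -/
theorem IsCritical.exists_span {G : ℝ≥0∞⟦X⟧} (hG : IsCritical G) :
    ∃ d ≥ 1, SuppMod d 0 G ∧
      ∃ h ≥ 1, ∃ x, coeff x (G ^ h) ≠ 0 ∧ coeff (x + d) (G ^ h) ≠ 0 := by
  classical
  have hex : ∃ d, 1 ≤ d ∧ ∃ h ≥ 1, ∃ x, coeff x (G ^ h) ≠ 0 ∧ coeff (x + d) (G ^ h) ≠ 0 := by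
    obtain ⟨r, hr, hr0⟩ := hG.large
    exact ⟨r, by omega, 1, le_rfl, 0, by simpa using hG.zero, by simpa using hr0⟩
  obtain ⟨hd, h, hh, x, hx, hxd⟩ := Nat.find_spec hex
  set d := Nat.find hex with hd_def
  refine ⟨d, hd, fun i hi => ?_, h, hh, x, hx, hxd⟩
  rw [ZMod.natCast_eq_zero_iff]
  by_contra hdi
  have hlt : i % d < d := Nat.mod_lt _ hd
  -- If `d` does not divide the atom `i`, put `q = i / d`. Then `q(x+d) + 0` and `qx + i` are both
  -- atoms of the power `hq + 1`, and their difference `i % d` contradicts the minimality of `d`.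
  refine Nat.find_min hex hlt ⟨Nat.pos_of_ne_zero fun h0 => hdi (Nat.dvd_of_mod_eq_zero h0),
    h * (i / d) + 1, by omega, (i / d) * (x + d) + 0, ?_, ?_⟩
  · rw [pow_succ, pow_mul]
    exact coeff_pow_mul_ne_zero (coeff_pow_ne_zero hxd _) hG.zero
  · rw [pow_succ, pow_mul]
    have h1 := coeff_pow_mul_ne_zero (coeff_pow_ne_zero hx (i / d)) hi
    have h2 := Nat.div_add_mod i d
    have h3 : i / d * (x + d) + 0 + i % d = i / d * x + i := by
      rw [mul_add, mul_comm (i / d) d]; omega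
    rwa [h3]

/-- Two atoms of `A` at distance `d` give a component `ε X^x (1 + X^d)`. -/
theorem exists_bernoulli_part {A : ℝ≥0∞⟦X⟧} (hA : wsum A 1 = 1) {x d : ℕ} (hd : 1 ≤ d)
    (hx : coeff x A ≠ 0) (hxd : coeff (x + d) A ≠ 0) :
    ∃ (ε : ℝ≥0∞) (R : ℝ≥0∞⟦X⟧), ε ≠ 0 ∧ A = C ε * (X ^ x * (X ^ d + 1)) + R ∧
      2 * ε + wsum R 1 = 1 := by
  have key : ∃ (ε : ℝ≥0∞) (R : ℝ≥0∞⟦X⟧), ε ≠ 0 ∧ A = C ε * (X ^ x * (X ^ d + 1)) + R := by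
    refine ⟨min (coeff x A) (coeff (x + d) A), mk fun j => coeff j A -
      (if j = x + d ∨ j = x then min (coeff x A) (coeff (x + d) A) else 0), ?_, ?_⟩
    · rcases min_choice (coeff x A) (coeff (x + d) A) with h | h <;> rw [h] <;> assumption
    · ext j
      simp only [mul_add, ← pow_add, mul_one, map_add, coeff_C_mul, coeff_X_pow, coeff_mk]
      by_cases h1 : j = x
      · have h2 : j ≠ x + d := by omega
        subst h1
        simp [show ¬ d = 0 by omega]
      · by_cases h2 : j = x + d
        · subst h2
          simp [show ¬ d = 0 by omega]
        · simp [h1, h2]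
  obtain ⟨ε, R, h1, h2⟩ := key
  refine ⟨ε, R, h1, h2, ?_⟩
  rw [← hA]
  conv_rhs => rw [h2]
  rw [wsum_add, wsum_C_mul, wsum_mass_mul, wsum_add, wsum_X_pow, wsum_X_pow, wsum_one]
  simp only [Pi.one_apply, one_mul]
  rw [one_add_one_eq_two, mul_comm]

/-- The weight of the event that the Bernoulli component is used `l` times in `M` steps. -/
noncomputable def bernoulliPart (ε : ℝ≥0∞) (x : ℕ) (R D : ℝ≥0∞⟦X⟧) (M l : ℕ) : ℝ≥0∞⟦X⟧ :=
  C ((M.choose l : ℝ≥0∞) * ε ^ l) * (X ^ (x * l) * R ^ (M - l) * D)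

theorem pow_mul_eq_sum_bernoulliPart {A R : ℝ≥0∞⟦X⟧} {ε : ℝ≥0∞} {x d : ℕ}
    (hA : A = C ε * (X ^ x * (X ^ d + 1)) + R) (D : ℝ≥0∞⟦X⟧) (M : ℕ) :
    A ^ M * D = ∑ l ∈ Finset.range (M + 1), bernoulliPart ε x R D M l * (X ^ d + 1) ^ l := by
  rw [hA, add_pow, Finset.sum_mul]
  refine Finset.sum_congr rfl fun l _ => ?_
  rw [bernoulliPart, map_mul, map_pow, map_natCast, mul_pow, mul_pow, ← pow_mul]
  ring

theorem two_pow_mul_bernoulliPart_mass {ε : ℝ≥0∞} {x : ℕ} {R D : ℝ≥0∞⟦X⟧} (hD : wsum D 1 = 1)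
    (M l : ℕ) : 2 ^ l * wsum (bernoulliPart ε x R D M l) 1 =
      M.choose l * (2 * ε) ^ l * wsum R 1 ^ (M - l) := by
  rw [bernoulliPart, wsum_C_mul, wsum_mass_mul, wsum_mass_mul, wsum_X_pow, wsum_mass_pow, hD]
  simp only [Pi.one_apply, one_mul, mul_one, mul_pow]
  ring

theorem sum_binomial_eq_one (M : ℕ) {a b : ℝ≥0∞} (hab : a + b = 1) :
    ∑ l ∈ Finset.range (M + 1), (M.choose l : ℝ≥0∞) * a ^ l * b ^ (M - l) = 1 := by
  have h : (a + b) ^ M = 1 := by rw [hab, one_pow]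
  rw [← h, add_pow]
  exact Finset.sum_congr rfl fun l _ => by ring

theorem sum_binomial_mul_inv_le_ofReal (M : ℕ) {a : ℝ} {b : ℝ≥0∞} (ha : 0 < a)
    (hab : ENNReal.ofReal a + b = 1) :
    (∑ l ∈ Finset.range (M + 1), (M.choose l : ℝ≥0∞) * ENNReal.ofReal a ^ l * b ^ (M - l) *
      ((l : ℝ≥0∞) + 1)⁻¹) ≤ ENNReal.ofReal (1 / ((M + 1) * a)) := by
  have h := sum_binomial_mul_inv_le M _ _ hab
  have h2 : ((M : ℝ≥0∞) + 1) * ENNReal.ofReal a = ENNReal.ofReal ((M + 1) * a) := by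
    rw [ENNReal.ofReal_mul (by positivity), ENNReal.ofReal_add (by positivity) (by positivity)]
    simp
  rw [h2] at h
  rw [one_div, ENNReal.ofReal_inv_of_pos (by positivity)]
  exact (ENNReal.le_inv_iff_mul_le).2 h

/-- Jensen's inequality for the square root, in tangent form: `w ≤ t/2 + w^2/(2t)` with `w =
(l+1)^(-1/2)`, where `t` is chosen as the bound to be proved, so that both halves contribute `t/2`.
-/
theorem sum_binomial_mul_sqrt_le (M : ℕ) {a : ℝ} {b : ℝ≥0∞} (ha : 0 < a)
    (hab : ENNReal.ofReal a + b = 1) :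
    (∑ l ∈ Finset.range (M + 1), (M.choose l : ℝ≥0∞) * ENNReal.ofReal a ^ l * b ^ (M - l) *
      ENNReal.ofReal (1 / √(l + 1))) ≤ ENNReal.ofReal (1 / √((M + 1) * a)) := by
  set t : ℝ := 1 / √((M + 1) * a) with ht
  have hu : 0 < √((M + 1) * a) := by positivity
  have ht0 : 0 < t := by positivity
  have hpt : ∀ l : ℕ, ENNReal.ofReal (1 / √((l : ℝ) + 1)) ≤
      ENNReal.ofReal (t / 2) + ENNReal.ofReal (1 / (2 * t)) * ((l : ℝ≥0∞) + 1)⁻¹ := by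
    intro l
    have h1 : ((l : ℝ≥0∞) + 1)⁻¹ = ENNReal.ofReal (1 / ((l : ℝ) + 1)) := by
      rw [one_div, ENNReal.ofReal_inv_of_pos (by positivity),
        ENNReal.ofReal_add (by positivity) (by positivity)]; simp
    rw [h1, ← ENNReal.ofReal_mul (by positivity), ← ENNReal.ofReal_add (by positivity)
      (by positivity)]
    refine ENNReal.ofReal_le_ofReal ?_
    set w : ℝ := 1 / √((l : ℝ) + 1) with hw
    have h2 : 1 / ((l : ℝ) + 1) = w ^ 2 := by
      rw [hw, div_pow, Real.sq_sqrt (by positivity)]; simp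
    rw [h2]
    have h3 : t / 2 + 1 / (2 * t) * w ^ 2 - w = (t - w) ^ 2 / (2 * t) := by field_simp; ring
    have : 0 ≤ (t - w) ^ 2 / (2 * t) := by positivity
    linarith
  calc _ ≤ ∑ l ∈ Finset.range (M + 1), ((M.choose l : ℝ≥0∞) * ENNReal.ofReal a ^ l * b ^ (M - l) *
        ENNReal.ofReal (t / 2) + ENNReal.ofReal (1 / (2 * t)) * ((M.choose l : ℝ≥0∞) *
          ENNReal.ofReal a ^ l * b ^ (M - l) * ((l : ℝ≥0∞) + 1)⁻¹)) := by
        refine Finset.sum_le_sum fun l _ => ?_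
        refine (mul_le_mul_right (hpt l) _).trans (le_of_eq ?_)
        ring
    _ ≤ ENNReal.ofReal (t / 2) + ENNReal.ofReal (1 / (2 * t)) *
          ENNReal.ofReal (1 / ((M + 1) * a)) := by
        rw [Finset.sum_add_distrib, ← Finset.sum_mul, ← Finset.mul_sum, sum_binomial_eq_one M hab,
          one_mul]
        gcongr
        exact sum_binomial_mul_inv_le_ofReal M ha hab
    _ = ENNReal.ofReal t := by
        rw [← ENNReal.ofReal_mul (by positivity), ← ENNReal.ofReal_add (by positivity)
          (by positivity)]
        congr 1
        have : 1 / (((M : ℝ) + 1) * a) = t ^ 2 := by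
          rw [ht, div_pow, Real.sq_sqrt (by positivity)]; simp
        rw [this]; field_simp; ring

theorem two_mul_eq_ofReal {ε b : ℝ≥0∞} (h0 : ε ≠ 0) (h : 2 * ε + b = 1) :
    ∃ a : ℝ, 0 < a ∧ 2 * ε = ENNReal.ofReal a := by
  have h1 : 2 * ε ≠ ⊤ := ne_top_of_le_ne_top ENNReal.one_ne_top (h ▸ le_self_add)
  exact ⟨(2 * ε).toReal, ENNReal.toReal_pos (by simpa using h0) h1, (ENNReal.ofReal_toReal h1).symm⟩

/-- Concentration bound: the atoms of the `m`-fold convolution power are `O(m^(-1/2))`. -/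
theorem IsCritical.exists_coeff_pow_le {G : ℝ≥0∞⟦X⟧} (hG : IsCritical G) :
    ∃ c : ℝ, 0 < c ∧ ∀ m : ℕ, 1 ≤ m → ∀ j, coeff j (G ^ m) ≤ ENNReal.ofReal (c / √m) := by
  obtain ⟨d, hd, -, h, hh, x, hx, hxd⟩ := hG.exists_span
  obtain ⟨ε, R, hε, hA, hmass⟩ := exists_bernoulli_part (hG.pow_mass h) hd hx hxd
  obtain ⟨a, ha, hεa⟩ := two_mul_eq_ofReal hε hmass
  -- Among `m / h` blocks of `h` steps, a binomial number `l` use the Bernoulli component. Given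
  -- `l`, no atom exceeds `(l+1)^(-1/2)`, and the remaining factors only average this bound. The
  -- constant converts `m / h + 1` blocks into `m` steps.
  refine ⟨√(h / a), by positivity, fun m hm j => ?_⟩
  have hm' : G ^ m = (G ^ h) ^ (m / h) * G ^ (m % h) := by
    rw [← pow_mul, ← pow_add, Nat.div_add_mod]
  rw [hm', pow_mul_eq_sum_bernoulliPart hA, map_sum]
  calc _ ≤ ∑ l ∈ Finset.range (m / h + 1), ((m / h).choose l : ℝ≥0∞) * ENNReal.ofReal a ^ l *
        (wsum R 1) ^ (m / h - l) * ENNReal.ofReal (1 / √(l + 1)) := by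
        refine Finset.sum_le_sum fun l _ => ?_
        refine (coeff_mul_le _ _ (fun n => coeff_X_pow_add_one_pow_le d l n hd) j).trans
          (le_of_eq ?_)
        rw [← hεa, ← two_pow_mul_bernoulliPart_mass (x := x) (hG.pow_mass (m % h))]
        ring
    _ ≤ ENNReal.ofReal (1 / √(((m / h : ℕ) + 1) * a)) :=
        sum_binomial_mul_sqrt_le _ ha (hεa ▸ hmass)
    _ ≤ _ := by
        refine ENNReal.ofReal_le_ofReal ?_
        have hh' : (0 : ℝ) < h := by positivity
        have hm0 : (0 : ℝ) < m := by positivity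
        have h1 : (m : ℝ) ≤ h * ((m / h : ℕ) + 1) := by
          have := (Nat.lt_mul_div_succ m (show 0 < h by omega)).le
          exact_mod_cast this
        rw [← Real.sqrt_div (by positivity), ← Real.sqrt_one, ← Real.sqrt_div zero_le_one]
        refine Real.sqrt_le_sqrt ?_
        rw [Real.sqrt_one, div_div, div_le_div_iff₀ (by positivity) (by positivity)]
        nlinarith

theorem wsum_ite_add_le {B : ℝ≥0∞⟦X⟧} {c : ℝ≥0∞} (h : ∀ n, coeff n B ≤ c) (a n : ℕ) :
    wsum B (fun b => if a + b = n then 1 else 0) ≤ c := by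
  have := coeff_mul_le (X ^ a) B h n
  rwa [wsum_X_pow, Pi.one_apply, one_mul, coeff_eq_wsum, wsum_X_pow_mul] at this

/-- Decay of the lower tail: `P(S_m = m - N) = O(1 / N)` uniformly in `m`. -/
theorem IsCritical.exists_coeff_pow_sub_le {G : ℝ≥0∞⟦X⟧} (hG : IsCritical G) :
    ∃ c : ℝ, 0 < c ∧ ∀ m N : ℕ, 1 ≤ N → N ≤ m →
      coeff (m - N) (G ^ m) ≤ ENNReal.ofReal (c / N) := by
  obtain ⟨c, hc, hcon⟩ := hG.exists_coeff_pow_le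
  set V := (var G).toReal with hV
  have hV' : var G = ENNReal.ofReal V := (ENNReal.ofReal_toReal hG.var_ne_top).symm
  have hV0 : 0 ≤ V := ENNReal.toReal_nonneg
  -- The square root comes from the final computation; the extra `1` covers `m = 1`, where the atom
  -- is at most one.
  refine ⟨√(8 * V * c * c) + 1, by positivity, fun m N hN hNm => ?_⟩
  have hN0 : (0 : ℝ) < N := by positivity
  rcases Nat.lt_or_ge m 2 with hm | hm
  · obtain rfl : N = 1 := by omega
    refine (hG.coeff_pow_le_one _ _).trans ?_
    rw [← ENNReal.ofReal_one]
    exact ENNReal.ofReal_le_ofReal (by simp)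
  set j := m - N with hj
  set m₁ := m / 2
  set m₂ := m - m₁
  have hm1 : 1 ≤ m₁ := by omega
  have hm2 : 1 ≤ m₂ := by omega
  have hm12 : m₁ + m₂ = m := by omega
  have hG12 : G ^ m = G ^ m₁ * G ^ m₂ := by rw [← pow_add, hm12]
  -- Split the walk into two halves. The total deviation `-N` is the sum of the two deviations, so
  -- `N^2` is at most twice the sum of their squares. Each square is then averaged against the
  -- concentration bound for the other half, which costs only `m^(-1/2)`.
  have hpt : ∀ a b : ℕ, ENNReal.ofReal ((N : ℝ) ^ 2) * (if a + b = j then 1 else 0) ≤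
      2 * (ENNReal.ofReal (((a : ℝ) - m₁) ^ 2) * (if a + b = j then 1 else 0)) +
      2 * ((if a + b = j then 1 else 0) * ENNReal.ofReal (((b : ℝ) - m₂) ^ 2)) := by
    intro a b
    split_ifs with hab
    · rw [mul_one, mul_one, one_mul, ← mul_add, ← ENNReal.ofReal_add (by positivity)
        (by positivity), ← ENNReal.ofReal_ofNat 2, ← ENNReal.ofReal_mul (by positivity)]
      refine ENNReal.ofReal_le_ofReal ?_
      have e1 : (a : ℝ) + b + N = m₁ + m₂ := by exact_mod_cast (by omega : a + b + N = m₁ + m₂)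
      have e2 : (N : ℝ) = -((a - m₁) + (b - m₂)) := by linarith
      rw [e2]
      nlinarith [sq_nonneg ((a - m₁ : ℝ) - (b - m₂))]
    · simp
  have hmR : (2 : ℝ) ≤ m := by exact_mod_cast hm
  have hb : ∀ m' : ℕ, 1 ≤ m' → m ≤ 4 * m' → ∀ a,
      coeff a (G ^ m') ≤ ENNReal.ofReal (2 * c / √m) := by
    intro m' h1 h2 a
    refine (hcon m' h1 a).trans (ENNReal.ofReal_le_ofReal ?_)
    have h1' : (0 : ℝ) < m' := by exact_mod_cast h1
    have h3 : √(m : ℝ) ≤ 2 * √(m' : ℝ) := by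
      rw [Real.sqrt_le_left (by positivity), mul_pow, Real.sq_sqrt (by positivity)]
      norm_num; exact_mod_cast h2
    rw [div_le_div_iff₀ (by positivity) (by positivity)]
    nlinarith
  have h1 : ENNReal.ofReal ((N : ℝ) ^ 2) * coeff j (G ^ m) ≤
      ENNReal.ofReal (4 * m * V * (2 * c / √m)) := by
    calc ENNReal.ofReal ((N : ℝ) ^ 2) * coeff j (G ^ m)
        = wsum (G ^ m₁) fun a => wsum (G ^ m₂) fun b =>
          ENNReal.ofReal ((N : ℝ) ^ 2) * (if a + b = j then 1 else 0) := by
          rw [coeff_eq_wsum, hG12, wsum_mul]; simp only [wsum_mul_left]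
      _ ≤ wsum (G ^ m₁) fun a => wsum (G ^ m₂) fun b =>
          2 * (ENNReal.ofReal (((a : ℝ) - m₁) ^ 2) * (if a + b = j then 1 else 0)) +
          2 * ((if a + b = j then 1 else 0) * ENNReal.ofReal (((b : ℝ) - m₂) ^ 2)) :=
          wsum_mono _ fun a _ => wsum_mono _ fun b _ => hpt a b
      _ = 2 * (wsum (G ^ m₁) fun a => ENNReal.ofReal (((a : ℝ) - m₁) ^ 2) *
            wsum (G ^ m₂) fun b => if a + b = j then 1 else 0) +
          2 * (wsum (G ^ m₂) fun b => (wsum (G ^ m₁) fun a => if b + a = j then 1 else 0) *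
            ENNReal.ofReal (((b : ℝ) - m₂) ^ 2)) := by
          simp only [wsum_add_right, wsum_mul_left]
          rw [wsum_comm]
          simp only [wsum_mul_right, add_comm]
      _ ≤ 2 * (wsum (G ^ m₁) fun a => ENNReal.ofReal (((a : ℝ) - m₁) ^ 2) *
            ENNReal.ofReal (2 * c / √m)) +
          2 * (wsum (G ^ m₂) fun b => ENNReal.ofReal (2 * c / √m) *
            ENNReal.ofReal (((b : ℝ) - m₂) ^ 2)) := by
          gcongr
          · exact wsum_mono _ fun a _ => by
              gcongr; exact wsum_ite_add_le (hb m₂ hm2 (by omega)) _ _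
          · exact wsum_mono _ fun b _ => by
              gcongr; exact wsum_ite_add_le (hb m₁ hm1 (by omega)) _ _
      _ = ENNReal.ofReal (2 * m * V * (2 * c / √m)) := by
          rw [wsum_mul_left, wsum_mul_right, hG.pow_var, hG.pow_var, hV']
          rw [ENNReal.ofReal_mul (by positivity), ENNReal.ofReal_mul (by positivity),
            ENNReal.ofReal_mul (by positivity), ENNReal.ofReal_natCast, ENNReal.ofReal_ofNat,
            ← hm12]
          push_cast; ring
      _ ≤ _ := by
          refine ENNReal.ofReal_le_ofReal ?_
          gcongr; norm_num
  have hfin : coeff j (G ^ m) ≠ ⊤ := ne_top_of_le_ne_top ENNReal.one_ne_top (hG.coeff_pow_le_one _ _)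
  set g := (coeff j (G ^ m)).toReal with hg
  have hg' : coeff j (G ^ m) = ENNReal.ofReal g := (ENNReal.ofReal_toReal hfin).symm
  have hg0 : 0 ≤ g := ENNReal.toReal_nonneg
  have h2 := hcon m (by omega) j
  have hsm : 0 < √(m : ℝ) := by positivity
  rw [hg', ENNReal.ofReal_le_ofReal_iff (by positivity)] at h2
  rw [hg', ← ENNReal.ofReal_mul (by positivity), ENNReal.ofReal_le_ofReal_iff (by positivity)] at h1
  rw [hg']
  refine ENNReal.ofReal_le_ofReal ?_
  rw [le_div_iff₀ hN0]
  refine le_trans ?_ (le_add_of_nonneg_right zero_le_one)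
  refine Real.le_sqrt_of_sq_le ?_
  -- Geometric mean of the two available bounds: `g = O(m^(-1/2))` by concentration and `N^2 g =
  -- O(m^(1/2))` by the variance; the powers of `m` cancel.
  calc (g * N) ^ 2 = g * (N ^ 2 * g) := by ring
    _ ≤ (c / √m) * (4 * m * V * (2 * c / √m)) := by gcongr
    _ = 8 * V * c * c * (m / (√m * √m)) := by field_simp; ring
    _ = 8 * V * c * c := by rw [Real.mul_self_sqrt (by positivity), div_self (by positivity), mul_one]

end GaltonWatson

/-! ### The local lower bound for atoms near the mean. -/

namespace GaltonWatson
open PowerSeries Finset.HasAntidiagonal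

theorem SuppMod.C_mul {d : ℕ} {r : ZMod d} {A : ℝ≥0∞⟦X⟧} (hA : SuppMod d r A) (c : ℝ≥0∞) :
    SuppMod d r (C c * A) := by
  intro n hn
  rw [coeff_C_mul] at hn
  exact hA n (right_ne_zero_of_mul hn)

/-- At a lattice point `j` close to the mean of the binomial smoothing, the smoothed weight is at
least of order `m^(-1/2)`. -/
theorem exists_sum_choose_ge (d : ℕ) (hd : 1 ≤ d) (κ K : ℝ) (hκ : 0 < κ) (hK : 0 ≤ K) :
    ∃ c > 0, ∃ M : ℕ, ∀ m ≥ M, ∀ l : ℕ, l ≤ m → κ * m ≤ l + 1 → ∀ j y : ℕ,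
      (j : ZMod d) = 0 → (y : ZMod d) = 0 → |(j : ℝ) - y - d * l / 2| ≤ K * √(m : ℝ) →
      2 ^ l * ENNReal.ofReal (c / √(m : ℝ)) ≤
        ∑ i ∈ Finset.range (l + 1), (l.choose i : ℝ≥0∞) * (if y + d * i = j then 1 else 0) := by
  obtain ⟨c, hc, L, hL⟩ := exists_choose_ge (K * √(2 / κ)) (by positivity)
  -- The first term makes `l ≥ κ m / 2` and `l ≥ L`; the second makes `K√m ≤ κ m / 4 ≤ d l / 2`, so
  -- that `y ≤ j` and `j - y` is a multiple of `d` in `ℕ`.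
  refine ⟨c, hc, ⌈(2 * (L + 1) / κ + (4 * (K + 1) / κ) ^ 2 + 1 : ℝ)⌉₊, ?_⟩
  intro m hm l hlm hl j y hj hy hjy
  have hm1 : (2 * (L + 1) / κ + (4 * (K + 1) / κ) ^ 2 + 1 : ℝ) ≤ m :=
    (Nat.le_ceil _).trans (by exact_mod_cast hm)
  have hm2 : 2 * (L + 1 : ℝ) ≤ κ * m := by
    rw [mul_comm κ, ← div_le_iff₀ hκ]; nlinarith [sq_nonneg (4 * (K + 1) / κ)]
  have hsq : √(m : ℝ) ^ 2 = m := Real.sq_sqrt (by positivity)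
  have hdiv : 0 ≤ 2 * (L + 1 : ℝ) / κ := by positivity
  have hm3 : 4 * (K + 1) ≤ κ * √(m : ℝ) := by
    rw [mul_comm κ, ← div_le_iff₀ hκ]
    exact Real.le_sqrt_of_sq_le (by linarith)
  have hm0 : (0 : ℝ) < m := by nlinarith [sq_nonneg (4 * (K + 1) / κ)]
  have hl2 : κ * m / 2 ≤ l := by linarith [Nat.cast_nonneg (α := ℝ) L]
  have hLl : L ≤ l := by
    have : (L : ℝ) ≤ l := by linarith
    exact_mod_cast this
  have hl0 : (0 : ℝ) < l := by nlinarith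
  have hsm : 0 < √(m : ℝ) := by positivity
  have hd1 : (1 : ℝ) ≤ d := by exact_mod_cast hd
  have hyj : y ≤ j := by
    have h1 : (d : ℝ) * l / 2 - K * √(m : ℝ) ≤ j - y := by linarith [(abs_le.1 hjy).1]
    have h2 : K * √(m : ℝ) ≤ κ * m / 4 := by
      have : K * √(m : ℝ) ≤ (κ * √(m : ℝ) / 4) * √(m : ℝ) := by
        gcongr; linarith
      nlinarith
    have h3 : (l : ℝ) ≤ d * l := by nlinarith
    have : (y : ℝ) ≤ j := by nlinarith
    exact_mod_cast this
  obtain ⟨i, hi⟩ : d ∣ j - y := by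
    rw [← ZMod.natCast_eq_zero_iff, Nat.cast_sub hyj, hj, hy, sub_zero]
  have hji : j = y + d * i := by omega
  have hi2 : |(i : ℝ) - l / 2| ≤ K * √(2 / κ) * √(l : ℝ) := by
    have h1 : (j : ℝ) - y - d * l / 2 = d * (i - l / 2) := by rw [hji]; push_cast; ring
    rw [h1, abs_mul, abs_of_nonneg (by positivity)] at hjy
    have h2 : √(m : ℝ) ≤ √(2 / κ) * √(l : ℝ) := by
      rw [← Real.sqrt_mul (by positivity)]
      refine Real.sqrt_le_sqrt ?_
      rw [div_mul_eq_mul_div, le_div_iff₀ hκ]; linarith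
    calc |(i : ℝ) - l / 2| ≤ d * |(i : ℝ) - l / 2| := by nlinarith [abs_nonneg ((i : ℝ) - l / 2)]
      _ ≤ K * √(m : ℝ) := hjy
      _ ≤ _ := by rw [mul_assoc]; gcongr
  have hch := hL l hLl i hi2
  have hil : i ≤ l := by
    by_contra h
    rw [Nat.choose_eq_zero_of_lt (by omega)] at hch
    have : 0 < c * 2 ^ l / √(l : ℝ) := by positivity
    simp at hch; linarith
  refine le_trans ?_ (Finset.single_le_sum (f := fun i => (l.choose i : ℝ≥0∞) *
    (if y + d * i = j then 1 else 0)) (fun _ _ => zero_le)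
    (Finset.mem_range.2 (Nat.lt_succ_of_le hil)))
  rw [if_pos hji.symm, mul_one, ← ENNReal.ofReal_natCast (l.choose i),
    show (2 : ℝ≥0∞) ^ l = ENNReal.ofReal (2 ^ l) by
      rw [ENNReal.ofReal_pow (by norm_num)]; simp, ← ENNReal.ofReal_mul (by positivity)]
  refine ENNReal.ofReal_le_ofReal (le_trans ?_ hch)
  rw [mul_div_assoc', mul_comm]
  gcongr

/-- Local lower bound: on the lattice of the offspring distribution, the atoms of the `m`-fold
convolution power at distance `O(√m)` from the mean are at least of order `m^(-1/2)`. -/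
theorem IsCritical.exists_local_lower {G : ℝ≥0∞⟦X⟧} (hG : IsCritical G) :
    ∃ d ≥ 1, SuppMod d 0 G ∧ ∀ B : ℝ, 0 ≤ B → ∃ c > 0, ∃ M : ℕ, ∀ m ≥ M, ∀ j : ℕ,
      (j : ZMod d) = 0 → |(j : ℝ) - m| ≤ B * √(m : ℝ) →
      ENNReal.ofReal (c / √(m : ℝ)) ≤ coeff j (G ^ m) := by
  classical
  obtain ⟨d, hd, hsupp, h, hh, x, hx, hxd⟩ := hG.exists_span
  refine ⟨d, hd, hsupp, fun B hB => ?_⟩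
  obtain ⟨ε, R, hε, hA, hmass⟩ := exists_bernoulli_part (hG.pow_mass h) hd hx hxd
  obtain ⟨a, ha, hεa⟩ := two_mul_eq_ofReal hε hmass
  set V := (var G).toReal with hV
  have hV' : var G = ENNReal.ofReal V := (ENNReal.ofReal_toReal hG.var_ne_top).symm
  have hV0 : 0 ≤ V := ENNReal.toReal_nonneg
  set K := √(4 * V + 1) with hK
  have hK2 : K ^ 2 = 4 * V + 1 := Real.sq_sqrt (by positivity)
  have hK0 : 0 < K := by positivity
  have hh0 : (0 : ℝ) < h := by positivity
  -- The value `a / (4h)` makes the weight of too few Bernoulli steps at most `1/4`, by Markov's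
  -- inequality for `1/(l+1)`. The choice `K^2 = 4V + 1` makes the weight of a conditional mean `y +
  -- dl/2` farther than `K√m` from `m` at most `1/4`, by Chebyshev. The radius `B + K` is the
  -- triangle inequality.
  obtain ⟨c, hc, M₀, hM₀⟩ := exists_sum_choose_ge d hd (a / (4 * h)) (B + K) (by positivity)
    (by positivity)
  refine ⟨c / 2, by positivity, M₀ + 1, fun m hm j hj hjm => ?_⟩
  have hm0 : (0 : ℝ) < m := by exact_mod_cast (by omega : 0 < m)
  set M := m / h with hM
  have hMm : (m : ℝ) ≤ h * (M + 1) := by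
    exact_mod_cast (Nat.lt_mul_div_succ m (show 0 < h by omega)).le
  have hMle : M ≤ m := Nat.div_le_self _ _
  set W := bernoulliPart ε x R (G ^ (m % h)) M with hW
  have hexp : G ^ m = ∑ l ∈ Finset.range (M + 1), W l * (X ^ d + 1) ^ l := by
    rw [hW, ← pow_mul_eq_sum_bernoulliPart hA, ← pow_mul, ← pow_add, Nat.div_add_mod]
  have hwsum : ∀ φ : ℕ → ℝ≥0∞, wsum (G ^ m) φ = ∑ l ∈ Finset.range (M + 1),
      wsum (W l) fun y => ∑ i ∈ Finset.range (l + 1), (l.choose i : ℝ≥0∞) * φ (y + d * i) := by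
    intro φ
    rw [hexp, wsum_sum]
    simp only [wsum_mul, wsum_X_pow_add_one_pow]
  have hWmass : ∀ l, 2 ^ l * wsum (W l) 1 =
      M.choose l * ENNReal.ofReal a ^ l * wsum R 1 ^ (M - l) := by
    intro l; rw [hW, two_pow_mul_bernoulliPart_mass (hG.pow_mass _), hεa]
  rw [hεa] at hmass
  have hRle : ∀ n, coeff n R ≤ coeff n (G ^ h) := by
    intro n; rw [hA, map_add]; exact le_add_self
  have hGpow : ∀ k, SuppMod d 0 (G ^ k) := by
    intro k; simpa using hsupp.pow k
  have hWsupp : ∀ l, SuppMod d 0 (W l) := by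
    intro l
    have hx0 : (x : ZMod d) = 0 := hGpow h x hx
    have h1 : SuppMod d 0 (X ^ (x * l)) := by
      have := suppMod_X_pow d (x * l)
      simpa [hx0] using this
    have h2 : SuppMod d 0 (R ^ (M - l)) := by
      simpa using ((hGpow h).mono hRle).pow (M - l)
    have h3 := ((h1.mul h2).mul (hGpow (m % h))).C_mul ((M.choose l : ℝ≥0∞) * ε ^ l)
    rw [add_zero, add_zero] at h3
    exact h3
  set good : ℕ → ℕ → ℝ≥0∞ := fun l y =>
    if a / (4 * h) * m ≤ l + 1 ∧ |(y : ℝ) + d * l / 2 - m| ≤ K * √(m : ℝ) then 1 else 0 with hgood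
  have hlow : ENNReal.ofReal (c / √(m : ℝ)) *
      ∑ l ∈ Finset.range (M + 1), 2 ^ l * wsum (W l) (good l) ≤ coeff j (G ^ m) := by
    rw [coeff_eq_wsum, hwsum, Finset.mul_sum]
    refine Finset.sum_le_sum fun l hl => ?_
    rw [← mul_assoc, ← wsum_mul_left]
    refine wsum_mono _ fun y hy => ?_
    simp only [hgood]
    split_ifs with hg
    · rw [mul_one, mul_comm]
      refine hM₀ m (by omega) l ?_ hg.1 j y hj (hWsupp l y hy) ?_
      · have := Finset.mem_range.1 hl; omega
      · rw [add_mul]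
        refine le_trans ?_ (add_le_add hjm hg.2)
        rw [← abs_neg ((y : ℝ) + d * l / 2 - m)]
        refine le_trans (le_of_eq ?_) (abs_add_le _ _)
        congr 1; ring
    · simp
  have htot : (1 : ℝ≥0∞) = ∑ l ∈ Finset.range (M + 1), 2 ^ l * wsum (W l) 1 := by
    simp only [hWmass]
    exact (sum_binomial_eq_one M hmass).symm
  -- Replacing the Bernoulli steps by their conditional mean does not increase the variance.
  have hvar : ∑ l ∈ Finset.range (M + 1), 2 ^ l * wsum (W l) (fun y =>
      ENNReal.ofReal (((y : ℝ) + d * l / 2 - m) ^ 2)) ≤ m * var G := by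
    rw [← hG.pow_var, hwsum]
    refine Finset.sum_le_sum fun l _ => ?_
    rw [← wsum_mul_left]
    refine wsum_mono _ fun y _ => ?_
    have := sq_le_sum_choose l d ((y : ℝ) - m)
    refine le_trans (le_of_eq ?_) (this.trans (le_of_eq ?_))
    · congr 3; ring
    · refine Finset.sum_congr rfl fun i _ => ?_
      congr 3; push_cast; ring
  have hinv : ∑ l ∈ Finset.range (M + 1), 2 ^ l * wsum (W l) (fun _ => ((l : ℝ≥0∞) + 1)⁻¹) ≤
      ENNReal.ofReal (1 / ((M + 1) * a)) := by
    refine le_trans (le_of_eq ?_) (sum_binomial_mul_inv_le_ofReal M ha hmass)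
    refine Finset.sum_congr rfl fun l _ => ?_
    rw [wsum_const, ← mul_assoc, hWmass]
  have hpt : ∀ l y : ℕ, (1 : ℝ≥0∞) ≤ good l y +
      (ENNReal.ofReal ((M + 1) * a / 4) * ((l : ℝ≥0∞) + 1)⁻¹ +
      ENNReal.ofReal (1 / (K ^ 2 * m)) * ENNReal.ofReal (((y : ℝ) + d * l / 2 - m) ^ 2)) := by
    intro l y
    by_cases h1 : a / (4 * h) * m ≤ l + 1
    · by_cases h2 : |(y : ℝ) + d * l / 2 - m| ≤ K * √(m : ℝ)
      · simp [hgood, h1, h2]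
      · refine le_trans ?_ le_add_self
        refine le_trans ?_ le_add_self
        rw [← ENNReal.ofReal_mul (by positivity), ← ENNReal.ofReal_one]
        refine ENNReal.ofReal_le_ofReal ?_
        push Not at h2
        have h3 : (K * √(m : ℝ)) ^ 2 ≤ ((y : ℝ) + d * l / 2 - m) ^ 2 := by
          rw [← sq_abs ((y : ℝ) + d * l / 2 - m)]; gcongr
        rw [mul_pow, Real.sq_sqrt hm0.le] at h3
        rw [one_div_mul_eq_div, le_div_iff₀ (by positivity), one_mul]
        exact h3
    · refine le_trans ?_ le_add_self
      refine le_trans ?_ le_self_add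
      have h1' : ((l : ℝ≥0∞) + 1)⁻¹ = ENNReal.ofReal (1 / ((l : ℝ) + 1)) := by
        rw [one_div, ENNReal.ofReal_inv_of_pos (by positivity),
          ENNReal.ofReal_add (by positivity) (by positivity)]; simp
      rw [h1', ← ENNReal.ofReal_mul (by positivity), ← ENNReal.ofReal_one]
      refine ENNReal.ofReal_le_ofReal ?_
      push Not at h1
      rw [mul_one_div, le_div_iff₀ (by positivity), one_mul]
      refine h1.le.trans ?_
      rw [div_mul_eq_mul_div, div_le_iff₀ (by positivity)]
      nlinarith
  have hsum : (1 : ℝ≥0∞) ≤ ∑ l ∈ Finset.range (M + 1), 2 ^ l * wsum (W l) (good l) + 1 / 2 := by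
    calc (1 : ℝ≥0∞) = ∑ l ∈ Finset.range (M + 1), 2 ^ l * wsum (W l) 1 := htot
      _ ≤ ∑ l ∈ Finset.range (M + 1), 2 ^ l * wsum (W l) (fun y => good l y +
          (ENNReal.ofReal ((M + 1) * a / 4) * ((l : ℝ≥0∞) + 1)⁻¹ +
          ENNReal.ofReal (1 / (K ^ 2 * m)) *
            ENNReal.ofReal (((y : ℝ) + d * l / 2 - m) ^ 2))) := by
          refine Finset.sum_le_sum fun l _ => ?_
          gcongr
          exact wsum_mono _ fun y _ => hpt l y
      _ = ∑ l ∈ Finset.range (M + 1), 2 ^ l * wsum (W l) (good l) +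
          (ENNReal.ofReal ((M + 1) * a / 4) *
            ∑ l ∈ Finset.range (M + 1), 2 ^ l * wsum (W l) (fun _ => ((l : ℝ≥0∞) + 1)⁻¹) +
          ENNReal.ofReal (1 / (K ^ 2 * m)) * ∑ l ∈ Finset.range (M + 1), 2 ^ l * wsum (W l)
            (fun y => ENNReal.ofReal (((y : ℝ) + d * l / 2 - m) ^ 2))) := by
          simp only [wsum_add_right, wsum_mul_left, mul_add, Finset.sum_add_distrib,
            Finset.mul_sum, mul_left_comm]
      _ ≤ ∑ l ∈ Finset.range (M + 1), 2 ^ l * wsum (W l) (good l) +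
          (ENNReal.ofReal ((M + 1) * a / 4) * ENNReal.ofReal (1 / ((M + 1) * a)) +
          ENNReal.ofReal (1 / (K ^ 2 * m)) * (m * var G)) := by
          gcongr
      _ ≤ _ := by
          gcongr
          rw [hV', ← ENNReal.ofReal_natCast m, ← ENNReal.ofReal_mul (by positivity),
            ← ENNReal.ofReal_mul (by positivity), ← ENNReal.ofReal_mul (by positivity),
            ← ENNReal.ofReal_add (by positivity) (by positivity),
            show (1 / 2 : ℝ≥0∞) = ENNReal.ofReal (1 / 2) by
              rw [ENNReal.ofReal_div_of_pos (by norm_num)]; simp]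
          refine ENNReal.ofReal_le_ofReal ?_
          have e1 : ((M : ℝ) + 1) * a / 4 * (1 / ((M + 1) * a)) = 1 / 4 := by field_simp
          have e2 : 1 / (K ^ 2 * m) * (m * V) = V / (4 * V + 1) := by rw [hK2]; field_simp
          have e3 : V / (4 * V + 1) ≤ 1 / 4 := by
            rw [div_le_div_iff₀ (by positivity) (by norm_num)]; linarith
          rw [e1, e2]; linarith
  have hhalf : (1 / 2 : ℝ≥0∞) ≤ ∑ l ∈ Finset.range (M + 1), 2 ^ l * wsum (W l) (good l) := by
    have h2 : (1 / 2 : ℝ≥0∞) ≠ ⊤ := by finiteness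
    refine (ENNReal.add_le_add_iff_right h2).1 (le_trans (le_of_eq ?_) hsum)
    rw [ENNReal.add_halves]
  refine le_trans ?_ hlow
  calc ENNReal.ofReal (c / 2 / √(m : ℝ)) = ENNReal.ofReal (c / √(m : ℝ)) * (1 / 2) := by
        rw [show c / 2 / √(m : ℝ) = c / √(m : ℝ) * (1 / 2) by ring,
          ENNReal.ofReal_mul (by positivity), ENNReal.ofReal_div_of_pos (x := 1) (by norm_num)]
        simp
    _ ≤ _ := by gcongr

end GaltonWatson

/-! ### Generating functions of trees with marked vertices. -/

namespace GaltonWatson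
open PowerSeries Finset.HasAntidiagonal

/-- Finite ordered forests: either empty, or a first tree, given by the forest of the subtrees of
its root, followed by a forest. A finite rooted ordered tree is given by the forest of the subtrees
of its root. -/
inductive Forest : Type
  | nil : Forest
  | cons (children siblings : Forest) : Forest

namespace Forest

/-- The number of trees. -/
def len : Forest → ℕ
  | nil => 0
  | cons _ s => s.len + 1

/-- The number of vertices. -/
def size : Forest → ℕ
  | nil => 0
  | cons c s => c.size + s.size + 1

/-- The number of vertices at height `i`. -/
def level : Forest → ℕ → ℕ
  | nil, _ => 0
  | cons _ s, 0 => 1 + s.level 0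
  | cons c s, i + 1 => c.level i + s.level (i + 1)

/-- The number of vertices at height `i` in the tree whose root has the given subtrees. -/
def treeLevel (c : Forest) : ℕ → ℕ
  | 0 => 1
  | i + 1 => c.level i

theorem level_cons (c s : Forest) (i : ℕ) : (cons c s).level i = c.treeLevel i + s.level i := by
  cases i <;> rfl

/-- The number of pairs of vertices in different trees with heights summing up to `l`. -/
def crossPairs : Forest → ℕ → ℕ
  | nil, _ => 0
  | cons c s, l => ∑ x ∈ antidiagonal l, c.treeLevel x.1 * s.level x.2 + s.crossPairs l

/-- The number of pairs of vertices at distance `k` connected through the root in the tree whose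
root has the given subtrees. -/
def rootPairs (c : Forest) (k : ℕ) : ℕ :=
  c.treeLevel k + if 2 ≤ k then c.crossPairs (k - 2) else 0

/-- The probability of the forest under the offspring distribution with generating function `G`. -/
noncomputable def weight (G : ℝ≥0∞⟦X⟧) : Forest → ℝ≥0∞
  | nil => 1
  | cons c s => coeff c.len G * c.weight G * s.weight G

/-- The first-child, next-sibling bijection; the recursions for forest generating functions come
from it. -/
theorem tsum_eq (φ : Forest → ℝ≥0∞) : ∑' f, φ f = φ nil + ∑' c, ∑' s, φ (cons c s) := by
  let e : Unit ⊕ Forest × Forest ≃ Forest :=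
    { toFun := Sum.elim (fun _ => nil) fun x => cons x.1 x.2
      invFun := fun f => match f with
        | nil => Sum.inl ()
        | cons c s => Sum.inr (c, s)
      left_inv := by rintro (_ | ⟨c, s⟩) <;> rfl
      right_inv := by rintro (_ | ⟨c, s⟩) <;> rfl }
  rw [← e.tsum_eq, Summable.tsum_sum ENNReal.summable ENNReal.summable, ENNReal.tsum_prod',
    tsum_fintype]
  simp [e]

end Forest
open Forest

/-- The product of a function of the first tree and a function of the remaining forest. -/
noncomputable def consProd (α β : Forest → ℝ≥0∞) : Forest → ℝ≥0∞
  | nil => 0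
  | cons c s => α c * β s

/-- The generating function, by size, of forests with `N` trees, counted with multiplicity `α`. -/
noncomputable def forestGF (G : ℝ≥0∞⟦X⟧) (N : ℕ) (α : Forest → ℝ≥0∞) : ℝ≥0∞⟦X⟧ :=
  mk fun n => ∑' f : Forest, if f.len = N ∧ f.size = n then f.weight G * α f else 0

/-- The generating function, by size, of trees counted with multiplicity `α`. -/
noncomputable def treeGF (G : ℝ≥0∞⟦X⟧) (α : Forest → ℝ≥0∞) : ℝ≥0∞⟦X⟧ :=
  mk fun n => ∑' c : Forest, if c.size + 1 = n then coeff c.len G * c.weight G * α c else 0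

variable (G : ℝ≥0∞⟦X⟧)

theorem forestGF_add (N : ℕ) (α β : Forest → ℝ≥0∞) :
    forestGF G N (fun f => α f + β f) = forestGF G N α + forestGF G N β := by
  ext n
  simp only [forestGF, map_add, coeff_mk, ← ENNReal.tsum_add]
  refine tsum_congr fun f => ?_
  split_ifs
  · rw [mul_add]
  · simp

theorem forestGF_sum {ι : Type*} (s : Finset ι) (N : ℕ) (α : ι → Forest → ℝ≥0∞) :
    forestGF G N (fun f => ∑ i ∈ s, α i f) = ∑ i ∈ s, forestGF G N (α i) := by
  classical
  induction s using Finset.induction_on with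
  | empty => ext n; simp [forestGF]
  | insert a s ha ih => simp only [Finset.sum_insert ha, forestGF_add, ih]

theorem treeGF_add (α β : Forest → ℝ≥0∞) :
    treeGF G (fun f => α f + β f) = treeGF G α + treeGF G β := by
  ext n
  simp only [treeGF, map_add, coeff_mk, ← ENNReal.tsum_add]
  refine tsum_congr fun f => ?_
  split_ifs
  · rw [mul_add]
  · simp

theorem forestGF_zero (α : Forest → ℝ≥0∞) : forestGF G 0 α = C (α nil) := by
  ext n
  rw [forestGF, coeff_mk, Forest.tsum_eq, coeff_C]
  simp [len, size, weight, eq_comm]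

theorem forestGF_succ (N : ℕ) (α : Forest → ℝ≥0∞) : forestGF G (N + 1) α =
    mk fun n => ∑' c : Forest, ∑' s : Forest, if s.len = N ∧ c.size + s.size + 1 = n then
      coeff c.len G * c.weight G * s.weight G * α (cons c s) else 0 := by
  ext n
  rw [forestGF, coeff_mk, Forest.tsum_eq, coeff_mk]
  simp [len, size, weight]

theorem forestGF_succ_mul (N : ℕ) (α β : Forest → ℝ≥0∞) :
    forestGF G (N + 1) (consProd α β) =
      treeGF G α * forestGF G N β := by
  rw [forestGF_succ]
  ext n
  simp only [coeff_mul, coeff_mk, treeGF, forestGF]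
  simp only [← ENNReal.tsum_mul_right]
  simp only [← ENNReal.tsum_mul_left]
  rw [← Summable.tsum_finsetSum (fun _ _ => ENNReal.summable)]
  refine tsum_congr fun c => ?_
  rw [← Summable.tsum_finsetSum (fun _ _ => ENNReal.summable)]
  refine tsum_congr fun s => ?_
  by_cases h : s.len = N ∧ c.size + s.size + 1 = n
  · rw [if_pos h, Finset.sum_eq_single (c.size + 1, s.size)]
    · simp only [h.1, consProd]; simp; ring
    · rintro ⟨a, b⟩ _ hab
      by_cases h1 : c.size + 1 = a
      · by_cases h2 : s.size = b
        · subst h1 h2; simp at hab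
        · simp [h2]
      · simp [h1]
    · intro h'; exact absurd (mem_antidiagonal.2 (by omega)) h'
  · rw [if_neg h, Finset.sum_eq_zero]
    rintro ⟨a, b⟩ hab
    rw [mem_antidiagonal] at hab
    by_cases h1 : c.size + 1 = a
    · by_cases h2 : s.len = N ∧ s.size = b
      · exact absurd ⟨h2.1, by simp at hab; omega⟩ h
      · simp [h2]
    · simp [h1]

theorem forestGF_congr (N : ℕ) {α β : Forest → ℝ≥0∞} (h : ∀ c s, α (cons c s) = β (cons c s)) :
    forestGF G (N + 1) α = forestGF G (N + 1) β := by
  simp only [forestGF_succ, h]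

theorem forestGF_one (N : ℕ) : forestGF G N (fun _ => 1) = treeGF G (fun _ => 1) ^ N := by
  induction N with
  | zero => rw [forestGF_zero]; simp
  | succ N ih =>
    rw [pow_succ', ← ih, ← forestGF_succ_mul]
    exact forestGF_congr G N fun c s => by simp [consProd]

/-- The `q`-th Hasse derivative. -/
noncomputable def hasse (q : ℕ) (G : ℝ≥0∞⟦X⟧) : ℝ≥0∞⟦X⟧ :=
  mk fun n => ((n + q).choose q : ℝ≥0∞) * coeff (n + q) G

theorem hasse_zero : hasse 0 G = G := by ext n; simp [hasse]

theorem wsum_hasse (q : ℕ) (φ : ℕ → ℝ≥0∞) :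
    wsum (hasse q G) φ = ∑' m, coeff m G * (m.choose q * φ (m - q)) := by
  rw [← (add_left_injective q).tsum_eq]
  · simp only [wsum, hasse, coeff_mk, Nat.add_sub_cancel]
    exact tsum_congr fun n => by ring
  · intro m hm
    refine ⟨m - q, ?_⟩
    by_contra h
    refine hm ?_
    dsimp only at h ⊢
    rw [Nat.choose_eq_zero_of_lt (by omega)]; simp

/-- Suppose the multiplicity involves `q` chosen subtrees of the root with joint contribution `K`,
and the other subtrees are unconstrained. Averaging `C(m,q) S^(m-q)` over the root degree `m` gives
the `q`-th Hasse derivative of `G` at `S`, and the root gives `X`. -/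
theorem treeGF_eq (q : ℕ) (α : Forest → ℝ≥0∞) (K : ℝ≥0∞⟦X⟧)
    (h : ∀ m, forestGF G m α = m.choose q * treeGF G (fun _ => 1) ^ (m - q) * K) :
    treeGF G α = X * comp (hasse q G) (treeGF G fun _ => 1) * K := by
  ext n
  cases n with
  | zero => simp [treeGF, mul_assoc]
  | succ n =>
    rw [mul_assoc, coeff_succ_X_mul]
    have h1 : coeff (n + 1) (treeGF G α) = ∑' m, coeff m G * coeff n (forestGF G m α) := by
      simp only [treeGF, forestGF, coeff_mk, ← ENNReal.tsum_mul_left]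
      rw [ENNReal.tsum_comm]
      refine tsum_congr fun c => ?_
      rw [tsum_eq_single c.len fun m hm => by rw [if_neg fun h => hm h.1.symm, mul_zero]]
      simp [mul_assoc]
    have h2 : ∀ m, forestGF G m α = C (m.choose q : ℝ≥0∞) * (treeGF G (fun _ => 1) ^ (m - q) * K) := by
      intro m; rw [h, map_natCast]; ring
    rw [h1]
    simp only [coeff_mul n (comp _ _) K, coeff_comp, ← wsum_mul_right]
    rw [← wsum_finset_sum_right, wsum_hasse]
    refine tsum_congr fun m => ?_
    rw [h2, coeff_C_mul, coeff_mul]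

/-- The generating function of the total progeny satisfies `S = X G(S)`. -/
theorem treeGF_one : treeGF G (fun _ => 1) = X * comp G (treeGF G fun _ => 1) := by
  have := treeGF_eq G 0 (fun _ => 1) 1 fun m => by rw [forestGF_one]; simp
  rwa [hasse_zero, mul_one] at this

theorem forestGF_level (N i : ℕ) : forestGF G N (fun f => (f.level i : ℝ≥0∞)) =
    N.choose 1 * treeGF G (fun _ => 1) ^ (N - 1) * treeGF G (fun c => (c.treeLevel i : ℝ≥0∞)) := by
  induction N with
  | zero => rw [forestGF_zero]; simp [level]
  | succ N ih =>
    rw [forestGF_congr G N (β := fun f =>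
      consProd (fun c => (c.treeLevel i : ℝ≥0∞)) (fun _ => 1) f +
      consProd (fun _ => 1) (fun s => (s.level i : ℝ≥0∞)) f)
      (fun c s => by simp [level_cons, consProd]), forestGF_add, forestGF_succ_mul, forestGF_succ_mul, ih,
      forestGF_one]
    cases N with
    | zero => simp
    | succ N => simp only [Nat.choose_one_right, Nat.add_sub_cancel]; push_cast; ring

/-- Decomposition along the ancestral line of the marked vertex: each proper ancestor gives `X
G'(S)`, and the subtree of the marked vertex gives `S`. -/
theorem treeGF_level (i : ℕ) : treeGF G (fun c => (c.treeLevel i : ℝ≥0∞)) =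
    X ^ i * comp (hasse 1 G ^ i * X) (treeGF G fun _ => 1) := by
  have h : ∀ i, treeGF G (fun c => (c.treeLevel i : ℝ≥0∞)) =
      (X * comp (hasse 1 G) (treeGF G fun _ => 1)) ^ i * treeGF G fun _ => 1 := by
    intro i
    induction i with
    | zero => simp [treeLevel]
    | succ i ih =>
      rw [pow_succ', mul_assoc, ← ih]
      exact treeGF_eq G 1 _ _ fun m => forestGF_level G m i
  rw [h, comp_mul, comp_X, comp_pow, mul_pow, mul_assoc]

/-- Two of the trees contain the marked vertices. The induction is Pascal's rule, according to
whether the first tree is one of them. -/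
theorem forestGF_crossPairs (N l : ℕ) : forestGF G N (fun f => (f.crossPairs l : ℝ≥0∞)) =
    N.choose 2 * treeGF G (fun _ => 1) ^ (N - 2) *
      ∑ x ∈ antidiagonal l, treeGF G (fun c => (c.treeLevel x.1 : ℝ≥0∞)) *
        treeGF G (fun c => (c.treeLevel x.2 : ℝ≥0∞)) := by
  induction N with
  | zero => rw [forestGF_zero]; simp [crossPairs]
  | succ N ih =>
    rw [forestGF_congr G N (β := fun f => (∑ x ∈ antidiagonal l,
        consProd (fun c => (c.treeLevel x.1 : ℝ≥0∞)) (fun s => (s.level x.2 : ℝ≥0∞)) f) +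
      consProd (fun _ => 1) (fun s => (s.crossPairs l : ℝ≥0∞)) f)
      (fun c s => by simp [crossPairs, consProd]), forestGF_add, forestGF_sum, forestGF_succ_mul, ih]
    simp only [fun x : ℕ × ℕ => forestGF_succ_mul G N (fun c => (c.treeLevel x.1 : ℝ≥0∞))
      (fun s => (s.level x.2 : ℝ≥0∞)), forestGF_level]
    have h : ∀ x : ℕ × ℕ, treeGF G (fun c => (c.treeLevel x.1 : ℝ≥0∞)) *
        (N.choose 1 * treeGF G (fun _ => 1) ^ (N - 1) *
          treeGF G (fun c => (c.treeLevel x.2 : ℝ≥0∞))) =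
        (N.choose 1 * treeGF G (fun _ => 1) ^ (N - 1)) *
        (treeGF G (fun c => (c.treeLevel x.1 : ℝ≥0∞)) *
          treeGF G (fun c => (c.treeLevel x.2 : ℝ≥0∞))) := fun x => by ring
    simp only [h, ← Finset.mul_sum]
    rcases N with _ | _ | N
    · simp
    · simp
    · rw [Nat.choose_succ_succ' (N + 1 + 1) 1]
      simp only [Nat.add_sub_cancel, show N + 1 + 1 - 2 = N by omega,
        show N + 1 + 1 + 1 - 2 = N + 1 by omega]
      push_cast; ring

/-- Every splitting of `l` between the two ancestral lines contributes the same product, whence the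
factor `l + 1`. This is the source of the factor `k` in the theorem. -/
theorem treeGF_crossPairs (l : ℕ) : treeGF G (fun c => (c.crossPairs l : ℝ≥0∞)) =
    ((l + 1 : ℕ) : ℝ≥0∞⟦X⟧) * (X ^ (l + 1) *
      comp (hasse 2 G * hasse 1 G ^ l * X ^ 2) (treeGF G fun _ => 1)) := by
  rw [treeGF_eq G 2 _ _ fun m => forestGF_crossPairs G m l]
  have h : ∀ x ∈ antidiagonal l, treeGF G (fun c => (c.treeLevel x.1 : ℝ≥0∞)) *
      treeGF G (fun c => (c.treeLevel x.2 : ℝ≥0∞)) =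
      X ^ l * (comp (hasse 1 G ^ l * X ^ 2) (treeGF G fun _ => 1)) := by
    intro x hx
    rw [← mem_antidiagonal.1 hx]
    simp only [treeGF_level, comp_mul, comp_pow, comp_X]
    ring
  rw [Finset.sum_congr rfl h, Finset.sum_const, Finset.Nat.card_antidiagonal, nsmul_eq_mul]
  simp only [comp_mul]
  push_cast
  ring

/-- The generating function of the number of pairs connected through the root. -/
theorem treeGF_rootPairs (k : ℕ) : treeGF G (fun c => (c.rootPairs k : ℝ≥0∞)) =
    X ^ k * comp (hasse 1 G ^ k * X) (treeGF G fun _ => 1) +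
    if 2 ≤ k then ((k - 1 : ℕ) : ℝ≥0∞⟦X⟧) * (X ^ (k - 1) *
      comp (hasse 2 G * hasse 1 G ^ (k - 2) * X ^ 2) (treeGF G fun _ => 1)) else 0 := by
  simp only [rootPairs]
  split_ifs with h
  · push_cast
    rw [treeGF_add, treeGF_level, treeGF_crossPairs, show k - 2 + 1 = k - 1 by omega]
  · rw [add_zero, ← treeGF_level]; simp

/-! ### The hitting time theorem. -/

theorem coeff_mul_eq_wsum (A B : ℝ≥0∞⟦X⟧) (n : ℕ) :
    coeff n (A * B) = wsum A fun i => if i ≤ n then coeff (n - i) B else 0 := by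
  rw [coeff_eq_wsum, wsum_mul]
  congr 1; ext i
  split_ifs with h
  · rw [coeff_eq_wsum]
    congr 1; ext b; congr 1
    exact propext (by omega)
  · have : ∀ b, ¬ i + b = n := by intro b; omega
    simp [this, wsum]

theorem wsum_X_mul_derivative (φ : ℕ → ℝ≥0∞) :
    wsum (X * derivative ℝ≥0∞ G) φ = wsum G fun i => i * φ i := by
  unfold wsum
  refine tsum_congr fun n => ?_
  cases n with
  | zero => simp
  | succ n => rw [coeff_succ_X_mul, coeff_derivative]; push_cast; ring

/-- `E[ξ₁; S_(m+1) = J] = (J / (m + 1)) P(S_(m+1) = J)`. -/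
theorem wsum_mul_coeff_pow (m J : ℕ) :
    (m + 1) * wsum G (fun i => i * if i ≤ J then coeff (J - i) (G ^ m) else 0) =
      J * coeff J (G ^ (m + 1)) := by
  rw [← wsum_X_mul_derivative, ← coeff_mul_eq_wsum]
  -- The exchangeability of the `m + 1` summands is the power rule for derivatives.
  have h : ((m + 1 : ℕ) : ℝ≥0∞⟦X⟧) * (X * derivative ℝ≥0∞ G * G ^ m) =
      X * derivative ℝ≥0∞ (G ^ (m + 1)) := by
    rw [derivative_pow, Nat.add_sub_cancel]; ring
  have h2 := congrArg (coeff J) h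
  rw [← map_natCast (C (R := ℝ≥0∞)), coeff_C_mul] at h2
  push_cast at h2
  rw [h2]
  cases J with
  | zero => simp
  | succ J => rw [coeff_succ_X_mul, coeff_derivative]; push_cast; ring

theorem coeff_treeGF_pow_of_lt {N m : ℕ} (h : m < N) :
    coeff m ((treeGF G fun _ => 1) ^ N) = 0 := by
  rw [treeGF_one, mul_pow, coeff_X_pow_mul', if_neg (by omega)]

/-- The hitting time theorem: `P(|F_N| = m) = (N / m) P(S_m = m - N)` for the total progeny of a
forest with `N` roots. -/
theorem mul_coeff_treeGF_pow (m N : ℕ) (h : N ≤ m) :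
    (m : ℝ≥0∞) * coeff m ((treeGF G fun _ => 1) ^ N) = N * coeff (m - N) (G ^ m) := by
  induction m generalizing N with
  | zero => simp [Nat.le_zero.1 h]
  | succ m ih =>
    cases N with
    | zero => simp [coeff_one]
    | succ N =>
      -- Removing the root of one tree by `S = X G(S)` leaves `N + i` trees of total size `m`, where
      -- `i` is the number of its children.
      have hrec : coeff (m + 1) ((treeGF G fun _ => 1) ^ (N + 1)) =
          wsum G fun i => coeff m ((treeGF G fun _ => 1) ^ (N + i)) := by
        rw [pow_succ]
        nth_rw 2 [treeGF_one]
        rw [mul_left_comm, coeff_succ_X_mul]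
        nth_rw 1 [← comp_X (treeGF G fun _ => 1)]
        rw [← comp_pow, ← comp_mul, coeff_comp, wsum_X_pow_mul]
      rcases Nat.eq_zero_or_pos m with rfl | hm
      · obtain rfl : N = 0 := by omega
        rw [hrec]
        simp only [zero_add, Nat.cast_one, one_mul, pow_one, Nat.sub_self]
        rw [wsum, tsum_eq_single 0]
        · simp
        · intro i hi
          rw [coeff_treeGF_pow_of_lt G (by omega), mul_zero]
      · set J := m - N with hJ
        -- The induction hypothesis supplies a factor `N + i`: its part `N` averages to an atom of
        -- `G^(m+1)`, its part `i` to the size-biased sum just computed.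
        have hstep : (m : ℝ≥0∞) * coeff (m + 1) ((treeGF G fun _ => 1) ^ (N + 1)) =
            N * coeff J (G ^ (m + 1)) +
            wsum G (fun i => i * if i ≤ J then coeff (J - i) (G ^ m) else 0) := by
          rw [hrec, ← wsum_mul_left, pow_succ', coeff_mul_eq_wsum, ← wsum_mul_left,
            ← wsum_add_right]
          congr 1; ext i
          by_cases hi : N + i ≤ m
          · rw [ih _ hi, if_pos (by omega), show J - i = m - (N + i) by omega]; push_cast; ring
          · rw [coeff_treeGF_pow_of_lt G (by omega), if_neg (by omega)]; simp
        have hm0 : (m : ℝ≥0∞) ≠ 0 := by simpa using hm.ne'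
        rw [← ENNReal.mul_right_inj hm0 (ENNReal.natCast_ne_top m)]
        calc (m : ℝ≥0∞) * ((m + 1 : ℕ) * coeff (m + 1) ((treeGF G fun _ => 1) ^ (N + 1)))
            = (m + 1) * ((m : ℝ≥0∞) * coeff (m + 1) ((treeGF G fun _ => 1) ^ (N + 1))) := by
              push_cast; ring
          _ = ((m + 1) * N + J) * coeff J (G ^ (m + 1)) := by
              rw [hstep, mul_add, wsum_mul_coeff_pow]; ring
          _ = _ := by
              have : (m + 1) * N + J = m * (N + 1) := by
                have : J + N = m := by omega
                nlinarith
              rw [show m + 1 - (N + 1) = J by omega, ← mul_assoc]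
              congr 1
              exact_mod_cast this

end GaltonWatson

/-! ### Two-sided bounds for the coefficients of numerator and denominator. -/

namespace GaltonWatson
open PowerSeries Finset.HasAntidiagonal
open Forest

theorem le_ofReal_div {m : ℕ} (hm : 1 ≤ m) {s : ℝ≥0∞} {x : ℝ} (h : m * s ≤ ENNReal.ofReal x) :
    s ≤ ENNReal.ofReal (x / m) := by
  have hm0 : (0 : ℝ) < m := by exact_mod_cast hm
  rw [ENNReal.ofReal_div_of_pos hm0, ENNReal.ofReal_natCast,
    ENNReal.le_div_iff_mul_le (Or.inl (by simp; omega)) (Or.inl (ENNReal.natCast_ne_top m)), mul_comm]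
  exact h

theorem ofReal_div_le {m : ℕ} (hm : 1 ≤ m) {s : ℝ≥0∞} {x : ℝ} (h : ENNReal.ofReal x ≤ m * s) :
    ENNReal.ofReal (x / m) ≤ s := by
  have hm0 : (0 : ℝ) < m := by exact_mod_cast hm
  rw [ENNReal.ofReal_div_of_pos hm0, ENNReal.ofReal_natCast]
  exact ENNReal.div_le_of_le_mul' h

theorem inv_natCast_add_one (l : ℕ) : ((l : ℝ≥0∞) + 1)⁻¹ = ENNReal.ofReal (1 / ((l : ℝ) + 1)) := by
  rw [one_div, ENNReal.ofReal_inv_of_pos (by positivity),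
    ENNReal.ofReal_add (by positivity) (by positivity)]; simp

theorem wsum_hasse_one_mass (G : ℝ≥0∞⟦X⟧) : wsum (hasse 1 G) 1 = wsum G fun n => (n : ℝ≥0∞) := by
  rw [wsum_hasse]; simp [wsum]

theorem mul_coeff_treeGF (G : ℝ≥0∞⟦X⟧) {n : ℕ} (hn : 1 ≤ n) :
    (n : ℝ≥0∞) * coeff n (treeGF G fun _ => 1) = coeff (n - 1) (G ^ n) := by
  simpa using mul_coeff_treeGF_pow G n 1 hn

namespace IsCritical
variable {G : ℝ≥0∞⟦X⟧} (hG : IsCritical G)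
include hG

theorem hasse_one_mass : wsum (hasse 1 G) 1 = 1 := by
  rw [wsum_hasse_one_mass, hG.mean]

theorem hasse_two_mass_ne_top : wsum (hasse 2 G) 1 ≠ ⊤ := by
  refine ne_top_of_le_ne_top hG.second ?_
  rw [wsum_hasse]
  refine ENNReal.tsum_le_tsum fun n => ?_
  gcongr
  rw [Pi.one_apply, mul_one]
  beta_reduce
  exact_mod_cast Nat.choose_le_pow n 2

theorem hasse_one_mean_ne_top : wsum (hasse 1 G) (fun n => (n : ℝ≥0∞)) ≠ ⊤ := by
  refine ne_top_of_le_ne_top hG.second ?_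
  rw [wsum_hasse]
  refine ENNReal.tsum_le_tsum fun n => ?_
  gcongr
  beta_reduce
  rw [Nat.choose_one_right, sq]
  gcongr
  omega

/-- The reciprocal moment of the `k`-fold convolution power of the size-biased offspring
distribution, shifted by one, is `O(1 / k)`. -/
theorem exists_wsum_hasse_pow_inv_le : ∃ q : ℝ, 0 < q ∧ ∀ k : ℕ,
    wsum (hasse 1 G ^ k) (fun b => ((b : ℝ≥0∞) + 1)⁻¹) ≤ ENNReal.ofReal (1 / ((k + 1) * q)) := by
  set A := hasse 1 G with hA
  set R : ℝ≥0∞⟦X⟧ := PowerSeries.mk fun n => coeff (n + 1) A with hR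
  have hdec : A = X * R + C (coeff 0 A) := by
    have := eq_X_mul_shift_add_const A
    simpa [hR] using this
  have hmass : wsum R 1 + coeff 0 A = 1 := by
    rw [← hG.hasse_one_mass, ← hA]
    conv_rhs => rw [hdec]
    rw [wsum_add, wsum_mass_mul, wsum_X, ← mul_one (C _), wsum_C_mul, wsum_one]; simp
  have hR0 : wsum R 1 ≠ 0 := by
    obtain ⟨r, hr, hr0⟩ := hG.large
    refine ne_of_gt (lt_of_lt_of_le (pos_iff_ne_zero.2 ?_) (coeff_le_mass R (r - 2)))
    rw [hR, coeff_mk, hA, hasse, coeff_mk, show r - 2 + 1 + 1 = r by omega]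
    simp; exact ⟨by omega, hr0⟩
  have hRt : wsum R 1 ≠ ⊤ := ne_top_of_le_ne_top ENNReal.one_ne_top (hmass ▸ le_self_add)
  have hRr := (ENNReal.ofReal_toReal hRt).symm
  refine ⟨(wsum R 1).toReal, ENNReal.toReal_pos hR0 hRt, fun k => ?_⟩
  refine le_trans ?_ (sum_binomial_mul_inv_le_ofReal k (ENNReal.toReal_pos hR0 hRt)
    (hRr ▸ hmass))
  rw [← hRr]
  -- Expand by the number `l` of nonzero summands, a binomial variable. The sum is at least `l`, so
  -- the binomial reciprocal moment applies.
  conv_lhs => rw [hdec, add_pow, wsum_sum]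
  refine Finset.sum_le_sum fun l _ => ?_
  rw [show (X * R) ^ l * C (coeff 0 A) ^ (k - l) * ((k.choose l : ℕ) : ℝ≥0∞⟦X⟧) =
    C ((k.choose l : ℝ≥0∞) * coeff 0 A ^ (k - l)) * (X ^ l * R ^ l) by
      rw [map_mul, map_pow, map_natCast]; ring, wsum_C_mul, wsum_X_pow_mul]
  have : wsum (R ^ l) (fun b => (((l + b : ℕ) : ℝ≥0∞) + 1)⁻¹) ≤
      wsum R 1 ^ l * ((l : ℝ≥0∞) + 1)⁻¹ := by
    rw [← wsum_mass_pow, ← wsum_const]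
    refine wsum_mono _ fun b _ => ?_
    gcongr
    omega
  refine (mul_le_mul_right this _).trans (le_of_eq ?_)
  ring

/-- Sizes of forests: `P(|F_N| = m) = O(1 / m)`, uniformly in `N`. -/
theorem exists_coeff_treeGF_pow_le : ∃ c : ℝ, 0 < c ∧ ∀ m N : ℕ, 1 ≤ N → 1 ≤ m →
    coeff m ((treeGF G fun _ => 1) ^ N) ≤ ENNReal.ofReal (c / m) := by
  obtain ⟨c, hc, h⟩ := hG.exists_coeff_pow_sub_le
  refine ⟨c, hc, fun m N hN hm => ?_⟩
  rcases lt_or_ge m N with hmN | hmN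
  · rw [coeff_treeGF_pow_of_lt G hmN]; exact zero_le
  · refine le_ofReal_div hm ?_
    rw [mul_coeff_treeGF_pow G m N hmN]
    have hN0 : (0 : ℝ) < N := by exact_mod_cast hN
    refine (mul_le_mul_right (h m N hN hmN) _).trans (le_of_eq ?_)
    rw [← ENNReal.ofReal_natCast, ← ENNReal.ofReal_mul (by positivity), mul_div_cancel₀ _ hN0.ne']

/-- A forest has size `m = n - t` with probability `O(1/m)`, which is too weak when `t` is close to
`n`. But `m` is at least the number of roots, hence at least `b + 1`, and the reciprocal of that has
mean `O(1/k)`. The condition `t ≤ k + 1` balances the two and is exactly what two ancestral lines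
require. -/
theorem exists_coeff_comp_le : ∃ c : ℝ, 0 < c ∧ ∀ (D : ℝ≥0∞⟦X⟧) (k q t n : ℕ), 1 ≤ q →
    t ≤ k + 1 → 1 ≤ n → coeff n (X ^ t * comp (D * hasse 1 G ^ k * X ^ q) (treeGF G fun _ => 1)) ≤
      wsum D 1 * ENNReal.ofReal (c / n) := by
  obtain ⟨c, hc, hS⟩ := hG.exists_coeff_treeGF_pow_le
  obtain ⟨p, hp, hinv⟩ := hG.exists_wsum_hasse_pow_inv_le
  refine ⟨c * (1 + 1 / p), by positivity, fun D k q t n hq ht hn => ?_⟩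
  have hn0 : (0 : ℝ) < n := by exact_mod_cast hn
  rw [coeff_X_pow_mul']
  split_ifs with htn
  swap
  · exact zero_le
  set m := n - t with hm
  have hpt : ∀ a b : ℕ, coeff m ((treeGF G fun _ => 1) ^ (a + b + q)) ≤
      ENNReal.ofReal (c / n) + ENNReal.ofReal (c * t / n) * ((b : ℝ≥0∞) + 1)⁻¹ := by
    intro a b
    rcases lt_or_ge m (a + b + q) with hlt | hge
    · rw [coeff_treeGF_pow_of_lt G hlt]; exact zero_le
    · have hm1 : 1 ≤ m := by omega
      refine (hS m _ (by omega) hm1).trans ?_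
      rw [inv_natCast_add_one, ← ENNReal.ofReal_mul (by positivity),
        ← ENNReal.ofReal_add (by positivity) (by positivity)]
      refine ENNReal.ofReal_le_ofReal ?_
      have hm0 : (0 : ℝ) < m := by exact_mod_cast hm1
      have hb : (b : ℝ) + 1 ≤ m := by exact_mod_cast (by omega : b + 1 ≤ m)
      have hnmt : (n : ℝ) = m + t := by exact_mod_cast (by omega : n = m + t)
      -- Partial fractions with `n = m + t`; in the last term `1/m` is then replaced by `1/(b+1)`.
      have e1 : c / m = c / n + c * t / n * (1 / m) := by
        rw [hnmt]; field_simp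
      rw [e1]
      gcongr
  rw [coeff_comp, wsum_mul, wsum_mul]
  simp only [wsum_X_pow]
  calc _ ≤ wsum D fun _ => wsum (hasse 1 G ^ k) fun b =>
        ENNReal.ofReal (c / n) + ENNReal.ofReal (c * t / n) * ((b : ℝ≥0∞) + 1)⁻¹ :=
        wsum_mono _ fun a _ => wsum_mono _ fun b _ => hpt a b
    _ ≤ _ := by
        rw [wsum_const]
        gcongr
        rw [wsum_add_right, wsum_const, wsum_mul_left, wsum_mass_pow, hG.hasse_one_mass, one_pow,
          one_mul]
        refine (add_le_add_right (mul_le_mul_right (hinv k) _) _).trans ?_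
        rw [← ENNReal.ofReal_mul (by positivity),
          ← ENNReal.ofReal_add (by positivity) (by positivity)]
        refine ENNReal.ofReal_le_ofReal ?_
        have ht' : (t : ℝ) ≤ k + 1 := by exact_mod_cast ht
        have e1 : c * t / n * (1 / ((k + 1) * p)) = c / n * (1 / p) * (t / (k + 1)) := by
          field_simp
        have e2 : (t : ℝ) / (k + 1) ≤ 1 := by
          rw [div_le_one (by positivity)]; exact ht'
        have e3 : c / n * (1 / p) * (t / (k + 1)) ≤ c / n * (1 / p) * 1 := by gcongr
        rw [e1]
        calc c / n + c / n * (1 / p) * (t / (k + 1)) ≤ c / n + c / n * (1 / p) * 1 := by linarith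
          _ = c * (1 + 1 / p) / n := by ring

/-- Upper bound for the expected number of pairs connected through the root. -/
theorem exists_coeff_rootPairs_le : ∃ c : ℝ, 0 < c ∧ ∀ k n : ℕ, 1 ≤ k → 1 ≤ n →
    coeff n (treeGF G fun f => (f.rootPairs k : ℝ≥0∞)) ≤ ENNReal.ofReal (c * k / n) := by
  obtain ⟨c, hc, h⟩ := hG.exists_coeff_comp_le
  set b := (wsum (hasse 2 G) 1).toReal with hb
  have hb' : wsum (hasse 2 G) 1 = ENNReal.ofReal b :=
    (ENNReal.ofReal_toReal hG.hasse_two_mass_ne_top).symm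
  have hb0 : 0 ≤ b := ENNReal.toReal_nonneg
  refine ⟨c * (1 + b), by positivity, fun k n hk hn => ?_⟩
  have hn0 : (0 : ℝ) < n := by exact_mod_cast hn
  have hk1 : (1 : ℝ) ≤ k := by exact_mod_cast hk
  rw [treeGF_rootPairs, map_add]
  have h1 : coeff n (X ^ k * comp (hasse 1 G ^ k * X) (treeGF G fun _ => 1)) ≤
      ENNReal.ofReal (c * k / n) := by
    have := h 1 k 1 k n le_rfl (by omega) hn
    rw [one_mul, pow_one, wsum_one, Pi.one_apply, one_mul] at this
    refine this.trans (ENNReal.ofReal_le_ofReal ?_)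
    gcongr; nlinarith
  have h2 : coeff n (if 2 ≤ k then ((k - 1 : ℕ) : ℝ≥0∞⟦X⟧) * (X ^ (k - 1) *
      comp (hasse 2 G * hasse 1 G ^ (k - 2) * X ^ 2) (treeGF G fun _ => 1)) else 0) ≤
      ENNReal.ofReal (c * b * k / n) := by
    split_ifs with hk2
    · rw [← map_natCast (C (R := ℝ≥0∞)), coeff_C_mul]
      have := h (hasse 2 G) (k - 2) 2 (k - 1) n (by norm_num) (by omega) hn
      refine (mul_le_mul_right this _).trans ?_
      rw [hb', ← ENNReal.ofReal_natCast, ← ENNReal.ofReal_mul (by positivity),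
        ← ENNReal.ofReal_mul (by positivity)]
      refine ENNReal.ofReal_le_ofReal ?_
      have : ((k - 1 : ℕ) : ℝ) ≤ k := by exact_mod_cast Nat.sub_le k 1
      calc ((k - 1 : ℕ) : ℝ) * (b * (c / n)) ≤ k * (b * (c / n)) := by gcongr
        _ = c * b * k / n := by ring
    · simp
  refine (add_le_add h1 h2).trans ?_
  rw [← ENNReal.ofReal_add (by positivity) (by positivity)]
  exact ENNReal.ofReal_le_ofReal (le_of_eq (by ring))

theorem exists_coeff_treeGF_le : ∃ c : ℝ, 0 < c ∧ ∀ n : ℕ, 1 ≤ n →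
    coeff n (treeGF G fun _ => 1) ≤ ENNReal.ofReal (c / (n * √(n : ℝ))) := by
  obtain ⟨c, hc, h⟩ := hG.exists_coeff_pow_le
  refine ⟨c, hc, fun n hn => ?_⟩
  rw [mul_comm, ← div_div]
  refine le_ofReal_div hn ?_
  rw [mul_coeff_treeGF G hn]
  exact h n hn _

/-- The hitting time theorem with one tree turns this into a lower bound for `P(S_n = n - 1)`.
Nonvanishing already puts `n - 1` on the lattice, at distance one from the mean, so the local bound
applies for large `n`. The finitely many small `n` only lower the constant. -/
theorem exists_le_coeff_treeGF : ∃ c : ℝ, 0 < c ∧ ∀ n : ℕ, 1 ≤ n →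
    coeff n (treeGF G fun _ => 1) ≠ 0 →
    ENNReal.ofReal (c / (n * √(n : ℝ))) ≤ coeff n (treeGF G fun _ => 1) := by
  obtain ⟨d, hd, hsupp, hloc⟩ := hG.exists_local_lower
  obtain ⟨c, hc, M, hM⟩ := hloc 1 zero_le_one
  have hfin : ∀ M : ℕ, ∃ c' : ℝ, 0 < c' ∧ ∀ n < M, coeff n (treeGF G fun _ => 1) ≠ 0 →
      ENNReal.ofReal c' ≤ coeff n (treeGF G fun _ => 1) := by
    intro M
    induction M with
    | zero => exact ⟨1, one_pos, by simp⟩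
    | succ M ih =>
      obtain ⟨c', hc', h⟩ := ih
      by_cases h0 : coeff M (treeGF G fun _ => 1) = 0
      · refine ⟨c', hc', fun n hn hn0 => h n ?_ hn0⟩
        rcases Nat.lt_succ_iff_lt_or_eq.1 hn with h1 | rfl
        · exact h1
        · exact absurd h0 hn0
      · obtain ⟨c'', -, h1, h2⟩ := ENNReal.lt_iff_exists_real_btwn.1 (pos_iff_ne_zero.2 h0)
        refine ⟨min c' c'', lt_min hc' (by simpa using h1), fun n hn hn0 => ?_⟩
        rcases Nat.lt_succ_iff_lt_or_eq.1 hn with h3 | rfl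
        · exact (ENNReal.ofReal_le_ofReal (min_le_left _ _)).trans (h n h3 hn0)
        · exact (ENNReal.ofReal_le_ofReal (min_le_right _ _)).trans h2.le
  obtain ⟨c', hc', hsmall⟩ := hfin M
  refine ⟨min c c', lt_min hc hc', fun n hn hn0 => ?_⟩
  have hn1 : (1 : ℝ) ≤ n := by exact_mod_cast hn
  have hs1 : 1 ≤ √(n : ℝ) := Real.one_le_sqrt.2 hn1
  rcases lt_or_ge n M with h | h
  · refine le_trans (ENNReal.ofReal_le_ofReal ?_) (hsmall n h hn0)
    rw [div_le_iff₀ (by positivity)]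
    have : 1 ≤ n * √(n : ℝ) := by nlinarith
    nlinarith [min_le_right c c']
  · rw [mul_comm, ← div_div]
    refine ofReal_div_le hn ?_
    rw [mul_coeff_treeGF G hn]
    have hcast : ((n - 1 : ℕ) : ℝ) = n - 1 := by rw [Nat.cast_sub hn]; simp
    refine le_trans (ENNReal.ofReal_le_ofReal ?_) (hM n h (n - 1) ?_ ?_)
    · gcongr; exact min_le_left _ _
    · have h1 : coeff (n - 1) (G ^ n) ≠ 0 := by
        rw [← mul_coeff_treeGF G hn]
        exact mul_ne_zero (by simp; omega) hn0
      simpa using hsupp.pow n _ h1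
    · rw [hcast]; simpa using hs1

/-- The `k`-fold convolution power of the size-biased offspring distribution puts mass of order
one on a window of order `√n` when `k` is of order `√n`. -/
theorem exists_window (a b : ℝ) (ha : 0 < a) (hb : 0 < b) : ∃ α β : ℝ, 0 < α ∧ 0 < β ∧
    ∀ k n : ℕ, 2 ≤ k → 1 ≤ n → a * √(n : ℝ) ≤ 2 * ((k : ℝ) - 2 + 1) → (k : ℝ) ≤ b * √(n : ℝ) →
      (1 / 2 : ℝ≥0∞) ≤ wsum (hasse 1 G ^ (k - 2)) fun y : ℕ =>
        if α * √(n : ℝ) ≤ y + 1 ∧ (y : ℝ) ≤ β * √(n : ℝ) then 1 else 0 := by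
  obtain ⟨p, hp, hinv⟩ := hG.exists_wsum_hasse_pow_inv_le
  set μ := (wsum (hasse 1 G) fun n => (n : ℝ≥0∞)).toReal with hμ
  have hμ' : (wsum (hasse 1 G) fun n => (n : ℝ≥0∞)) = ENNReal.ofReal μ :=
    (ENNReal.ofReal_toReal hG.hasse_one_mean_ne_top).symm
  have hμ0 : 0 ≤ μ := ENNReal.toReal_nonneg
  -- The two constants give each end of the window failure probability at most `1/4`, by Markov's
  -- inequality for `1/(y+1)` and for `y`; the `+ 1` in `β` keeps it positive.
  set α := a * p / 8 with hα
  set β := 4 * b * μ + 1 with hβ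
  have hα0 : 0 < α := by positivity
  have hβ0 : 0 < β := by positivity
  refine ⟨α, β, hα0, hβ0, fun k n hk2' hn hak hkb => ?_⟩
  have hn1 : (0 : ℝ) < n := by exact_mod_cast hn
  have hs0 : 0 < √(n : ℝ) := by positivity
  have hk2 : (2 : ℝ) ≤ k := by exact_mod_cast hk2'
  have hk2cast : ((k - 2 : ℕ) : ℝ) = k - 2 := by rw [Nat.cast_sub hk2']; simp
  set good : ℕ → ℝ≥0∞ := fun y =>
    if α * √(n : ℝ) ≤ y + 1 ∧ (y : ℝ) ≤ β * √(n : ℝ) then 1 else 0 with hgood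
  have hpt : ∀ y : ℕ, (1 : ℝ≥0∞) ≤ good y + (ENNReal.ofReal (α * √(n : ℝ)) *
      ((y : ℝ≥0∞) + 1)⁻¹ + ENNReal.ofReal (1 / (β * √(n : ℝ))) * y) := by
    intro y
    by_cases h1 : α * √(n : ℝ) ≤ y + 1
    · by_cases h2 : (y : ℝ) ≤ β * √(n : ℝ)
      · simp [hgood, h1, h2]
      · refine le_trans ?_ le_add_self
        refine le_trans ?_ le_add_self
        rw [← ENNReal.ofReal_natCast, ← ENNReal.ofReal_mul (by positivity), ← ENNReal.ofReal_one]
        refine ENNReal.ofReal_le_ofReal ?_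
        rw [one_div_mul_eq_div, le_div_iff₀ (by positivity), one_mul]
        exact (not_le.1 h2).le
    · refine le_trans ?_ le_add_self
      refine le_trans ?_ le_self_add
      rw [inv_natCast_add_one, ← ENNReal.ofReal_mul (by positivity), ← ENNReal.ofReal_one]
      refine ENNReal.ofReal_le_ofReal ?_
      rw [mul_one_div, le_div_iff₀ (by positivity), one_mul]
      exact (not_le.1 h1).le
  have hmean : wsum (hasse 1 G ^ (k - 2)) (fun y => (y : ℝ≥0∞)) ≤ ENNReal.ofReal (k * μ) := by
    rcases Nat.eq_zero_or_pos (k - 2) with h0 | h0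
    · rw [h0, pow_zero, wsum_one]; simp
    · obtain ⟨k', hk'⟩ := Nat.exists_eq_succ_of_ne_zero h0.ne'
      rw [hk', wsum_pow_id, hG.hasse_one_mass, hμ', one_pow, mul_one,
        ENNReal.ofReal_mul (by positivity), ENNReal.ofReal_natCast]
      gcongr
      exact_mod_cast (by omega : k' + 1 ≤ k)
  have h1 : (1 : ℝ≥0∞) ≤ wsum (hasse 1 G ^ (k - 2)) good + 1 / 2 := by
    calc (1 : ℝ≥0∞) = wsum (hasse 1 G ^ (k - 2)) (fun _ => 1) := by
          rw [wsum_const, wsum_mass_pow, hG.hasse_one_mass]; simp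
      _ ≤ _ := wsum_mono _ fun y _ => hpt y
      _ = wsum (hasse 1 G ^ (k - 2)) good + (ENNReal.ofReal (α * √(n : ℝ)) *
            wsum (hasse 1 G ^ (k - 2)) (fun y => ((y : ℝ≥0∞) + 1)⁻¹) +
          ENNReal.ofReal (1 / (β * √(n : ℝ))) *
            wsum (hasse 1 G ^ (k - 2)) (fun y => (y : ℝ≥0∞))) := by
          rw [wsum_add_right, wsum_add_right, wsum_mul_left, wsum_mul_left]
      _ ≤ wsum (hasse 1 G ^ (k - 2)) good + (ENNReal.ofReal (α * √(n : ℝ)) *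
            ENNReal.ofReal (1 / (((k - 2 : ℕ) + 1) * p)) +
          ENNReal.ofReal (1 / (β * √(n : ℝ))) * ENNReal.ofReal (k * μ)) := by
          gcongr
          exact hinv _
      _ ≤ _ := by
          gcongr
          rw [← ENNReal.ofReal_mul (by positivity), ← ENNReal.ofReal_mul (by positivity),
            ← ENNReal.ofReal_add (by positivity) (by positivity),
            show (1 / 2 : ℝ≥0∞) = ENNReal.ofReal (1 / 2) by
              rw [ENNReal.ofReal_div_of_pos (by norm_num)]; simp]
          refine ENNReal.ofReal_le_ofReal ?_
          rw [hk2cast]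
          have e1 : α * √(n : ℝ) * (1 / (((k : ℝ) - 2 + 1) * p)) ≤ 1 / 4 := by
            have hk1 : 0 < (k : ℝ) - 2 + 1 := by linarith
            rw [mul_one_div, div_le_iff₀ (by positivity), hα]
            have : a * √(n : ℝ) ≤ 2 * ((k : ℝ) - 2 + 1) := by linarith
            nlinarith
          have e2 : 1 / (β * √(n : ℝ)) * (k * μ) ≤ 1 / 4 := by
            rw [one_div_mul_eq_div, div_le_iff₀ (by positivity), hβ]
            have : k * μ ≤ b * √(n : ℝ) * μ := by gcongr
            nlinarith
          linarith
  have h2 : (1 / 2 : ℝ≥0∞) ≠ ⊤ := by finiteness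
  refine (ENNReal.add_le_add_iff_right h2).1 (le_trans (le_of_eq ?_) h1)
  rw [ENNReal.add_halves]

set_option maxHeartbeats 800000 in
/-- Lower bound for the expected number of pairs connected through the root. -/
theorem exists_le_coeff_rootPairs (a b : ℝ) (ha : 0 < a) (hb : 0 < b) : ∃ c : ℝ, 0 < c ∧
    ∃ N : ℕ, ∀ k n : ℕ, N ≤ n → coeff n (treeGF G fun _ => 1) ≠ 0 → a * √(n : ℝ) ≤ k →
      (k : ℝ) ≤ b * √(n : ℝ) → ENNReal.ofReal (c * k / n) ≤
        coeff n (treeGF G fun f => (f.rootPairs k : ℝ≥0∞)) := by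
  obtain ⟨d, hd, hsupp, hloc⟩ := hG.exists_local_lower
  obtain ⟨α, β, hα0, hβ0, hwin⟩ := hG.exists_window a b ha hb
  obtain ⟨r, hr, hr0⟩ := hG.large
  -- The forest has `r + y ≤ (r+β)√n` trees; the factor two accounts for `√n ≤ 2√m`.
  obtain ⟨c₀, hc₀, M, hM⟩ := hloc ((r + β) * 2) (by positivity)
  have hw0 : coeff (r - 2) (hasse 2 G) ≠ 0 := by
    rw [hasse, coeff_mk, show r - 2 + 2 = r by omega]
    refine mul_ne_zero ?_ hr0
    simpa using (Nat.choose_pos hr).ne'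
  have hwt : coeff (r - 2) (hasse 2 G) ≠ ⊤ :=
    ne_top_of_le_ne_top hG.hasse_two_mass_ne_top (coeff_le_mass _ _)
  set w := (coeff (r - 2) (hasse 2 G)).toReal with hw
  have hw' : coeff (r - 2) (hasse 2 G) = ENNReal.ofReal w := (ENNReal.ofReal_toReal hwt).symm
  have hwpos : 0 < w := ENNReal.toReal_pos hw0 hwt
  -- The threshold makes `m ≥ M`, `2k ≤ n`, `r + y ≤ m` and `k ≥ 2`. The factor `1/4` is the window
  -- mass `1/2` times `k - 1 ≥ k/2`.
  refine ⟨w * (α * c₀) / 4, by positivity, 2 * M +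
    ⌈(2 * b) ^ 2 + (2 * (r + β)) ^ 2 + (2 / a) ^ 2 + 1⌉₊, fun k n hNn hnS hak hkb => ?_⟩
  have hnbig : (2 * b) ^ 2 + (2 * (r + β)) ^ 2 + (2 / a) ^ 2 + 1 ≤ (n : ℝ) :=
    (Nat.le_ceil _).trans (by exact_mod_cast (by omega))
  have hnM : 2 * M ≤ n := by omega
  have hn1 : (1 : ℝ) ≤ n := by
    nlinarith [sq_nonneg (2 * b), sq_nonneg (2 * (r + β)), sq_nonneg (2 / a)]
  have hn : 1 ≤ n := by exact_mod_cast hn1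
  have hsq : √(n : ℝ) * √(n : ℝ) = n := Real.mul_self_sqrt (by positivity)
  have hs0 : 0 < √(n : ℝ) := by positivity
  have hs1 : 1 ≤ √(n : ℝ) := Real.one_le_sqrt.2 hn1
  have hsb : 2 * b ≤ √(n : ℝ) := Real.le_sqrt_of_sq_le (by
    nlinarith [sq_nonneg (2 * (r + β)), sq_nonneg (2 / a)])
  have hsr : 2 * (r + β) ≤ √(n : ℝ) := Real.le_sqrt_of_sq_le (by
    nlinarith [sq_nonneg (2 * b), sq_nonneg (2 / a)])
  have hsa : 2 / a ≤ √(n : ℝ) := Real.le_sqrt_of_sq_le (by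
    nlinarith [sq_nonneg (2 * b), sq_nonneg (2 * (r + β))])
  have hk2 : (2 : ℝ) ≤ k := by
    rw [div_le_iff₀ ha] at hsa; nlinarith
  have hk2' : 2 ≤ k := by exact_mod_cast hk2
  have hkn : 2 * (k : ℝ) ≤ n := by nlinarith
  have hkn' : 2 * k ≤ n := by exact_mod_cast hkn
  set m := n - (k - 1) with hm
  have hmn : n ≤ 2 * m := by omega
  have hmn' : m ≤ n := by omega
  have hm1 : 1 ≤ m := by omega
  have hm0 : (0 : ℝ) < m := by exact_mod_cast hm1
  have hmR : (n : ℝ) ≤ 2 * m := by exact_mod_cast hmn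
  have hmR' : (m : ℝ) ≤ n := by exact_mod_cast hmn'
  have hsm : √(n : ℝ) ≤ 2 * √(m : ℝ) := by
    rw [Real.sqrt_le_left (by positivity), mul_pow, Real.sq_sqrt (by positivity)]; linarith
  have hsm' : √(m : ℝ) ≤ √(n : ℝ) := Real.sqrt_le_sqrt hmR'
  -- The lattice condition is automatic: modulo the span, atoms of `G'` are `-1`, `r` is `0`, and
  -- `n` is `1` because `P(|T| = n) ≠ 0`.
  have hres : ∀ y : ℕ, coeff y (hasse 1 G ^ (k - 2)) ≠ 0 → r + y ≤ m →
      ((m - (r + y) : ℕ) : ZMod d) = 0 := by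
    intro y hy hym
    have h1 : SuppMod d (-1) (hasse 1 G) := by
      intro i hi
      rw [hasse, coeff_mk] at hi
      have := hsupp (i + 1) (right_ne_zero_of_mul hi)
      push_cast at this
      exact eq_neg_of_add_eq_zero_left this
    have h2 := h1.pow (k - 2) y hy
    have h3 : (r : ZMod d) = 0 := hsupp r hr0
    have h4 : ((n - 1 : ℕ) : ZMod d) = 0 := by
      have h5 : coeff (n - 1) (G ^ n) ≠ 0 := by
        rw [← mul_coeff_treeGF G hn]
        exact mul_ne_zero (by simp; omega) hnS
      simpa using hsupp.pow n _ h5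
    have h6 : ((m - (r + y) : ℕ) : ZMod d) + (r + y + (k - 2 : ℕ)) = ((n - 1 : ℕ) : ZMod d) := by
      exact_mod_cast congrArg (Nat.cast (R := ZMod d))
        (by omega : m - (r + y) + (r + y + (k - 2)) = n - 1)
    rw [h4, h3, h2] at h6
    simpa using h6
  set good : ℕ → ℝ≥0∞ := fun y =>
    if α * √(n : ℝ) ≤ y + 1 ∧ (y : ℝ) ≤ β * √(n : ℝ) then 1 else 0 with hgood
  have hlow : ∀ y : ℕ, coeff y (hasse 1 G ^ (k - 2)) ≠ 0 →
      ENNReal.ofReal (α * c₀ / n) * good y ≤ coeff m ((treeGF G fun _ => 1) ^ (r + y)) := by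
    intro y hy
    simp only [hgood]
    split_ifs with hg
    swap
    · simp
    have hry : ((r + y : ℕ) : ℝ) ≤ (r + β) * √(n : ℝ) := by
      push_cast
      nlinarith [hg.2, Nat.cast_nonneg (α := ℝ) r]
    have hrym : r + y ≤ m := by
      have : ((r + y : ℕ) : ℝ) ≤ m := by nlinarith
      exact_mod_cast this
    rw [mul_one]
    have h1 := hM m (by omega) (m - (r + y)) (hres y hy hrym) (by
      rw [Nat.cast_sub hrym, sub_sub_cancel_left, abs_neg, abs_of_nonneg (by positivity)]
      refine hry.trans ?_
      rw [mul_assoc]; gcongr)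
    have h2 := mul_coeff_treeGF_pow G m (r + y) hrym
    have h3 : ENNReal.ofReal ((r + y : ℕ) * (c₀ / √(m : ℝ))) ≤
        m * coeff m ((treeGF G fun _ => 1) ^ (r + y)) := by
      rw [h2, ENNReal.ofReal_mul (by positivity), ENNReal.ofReal_natCast]
      gcongr
    refine le_trans (ENNReal.ofReal_le_ofReal ?_) (ofReal_div_le hm1 h3)
    have h4 : α * √(n : ℝ) ≤ (r + y : ℕ) := by
      refine hg.1.trans ?_
      exact_mod_cast (by omega : y + 1 ≤ r + y)
    calc α * c₀ / n = α * √(n : ℝ) * (c₀ / √(n : ℝ)) / n := by field_simp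
      _ ≤ (r + y : ℕ) * (c₀ / √(m : ℝ)) / m := by gcongr
  have hmass : (1 / 2 : ℝ≥0∞) ≤ wsum (hasse 1 G ^ (k - 2)) good :=
    hwin k n hk2' hn (by linarith) hkb
  have hcoef : ENNReal.ofReal w * (ENNReal.ofReal (α * c₀ / n) * (1 / 2)) ≤
      coeff n (X ^ (k - 1) * comp (hasse 2 G * hasse 1 G ^ (k - 2) * X ^ 2)
        (treeGF G fun _ => 1)) := by
    rw [coeff_X_pow_mul', if_pos (by omega), coeff_comp, mul_assoc, wsum_mul]
    -- One atom of `G''/2` suffices, namely a root with `r` children, two of them on the marked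
    -- lines.
    refine le_trans ?_ (wsum_mono_left (A := C (coeff (r - 2) (hasse 2 G)) * X ^ (r - 2)) ?_ _)
    · rw [wsum_C_mul, wsum_X_pow, wsum_mul, ← hw']
      simp only [wsum_X_pow]
      gcongr
      calc _ ≤ ENNReal.ofReal (α * c₀ / n) * wsum (hasse 1 G ^ (k - 2)) good := by gcongr
        _ = wsum (hasse 1 G ^ (k - 2)) fun y => ENNReal.ofReal (α * c₀ / n) * good y :=
          (wsum_mul_left _ _ _).symm
        _ ≤ _ := wsum_mono _ fun y hy => by
          refine (hlow y hy).trans (le_of_eq ?_)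
          rw [show r - 2 + (y + 2) = r + y by omega]
    · intro i
      rw [coeff_C_mul, coeff_X_pow]
      split_ifs with hi
      · rw [hi, mul_one]
      · simp
  rw [treeGF_rootPairs, if_pos hk2', map_add, ← map_natCast (C (R := ℝ≥0∞)), coeff_C_mul]
  -- Pairs having the root as an endpoint are dropped.
  refine le_trans ?_ le_add_self
  refine le_trans ?_ (mul_le_mul_right hcoef _)
  rw [show (1 / 2 : ℝ≥0∞) = ENNReal.ofReal (1 / 2) by
      rw [ENNReal.ofReal_div_of_pos (by norm_num)]; simp, ← ENNReal.ofReal_natCast,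
    ← ENNReal.ofReal_mul (by positivity), ← ENNReal.ofReal_mul (by positivity),
    ← ENNReal.ofReal_mul (by positivity)]
  refine ENNReal.ofReal_le_ofReal ?_
  have hk1cast : ((k - 1 : ℕ) : ℝ) = k - 1 := by rw [Nat.cast_sub (by omega)]; simp
  rw [hk1cast]
  calc w * (α * c₀) / 4 * k / n = (k / 2) * (w * (α * c₀ / n * (1 / 2))) := by ring
    _ ≤ (k - 1) * (w * (α * c₀ / n * (1 / 2))) := by gcongr; linarith

end IsCritical

end GaltonWatson

/-! ### Finite family trees as forests. -/

namespace GaltonWatson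
open PowerSeries Finset.HasAntidiagonal
open Forest

theorem cons_mem_familyTree (ω : List ℕ → ℕ) (b : ℕ) (u : List ℕ) :
    b :: u ∈ familyTree ω ↔ b < ω [] ∧ u ∈ familyTree fun v => ω (b :: v) := by
  constructor
  · intro h
    refine ⟨h [] b (by simp), fun v i hv => h (b :: v) i ?_⟩
    simpa using hv
  · rintro ⟨hb, hu⟩ v i hv
    cases v with
    | nil => simp at hv; exact hv ▸ hb
    | cons c v =>
      rw [List.cons_append, List.cons_prefix_cons] at hv
      obtain ⟨rfl, hv⟩ := hv
      exact hu v i hv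

namespace Forest

/-- The vertices of the forest, as words, with the first tree attached to `[a]`. -/
def words : Forest → ℕ → Finset (List ℕ)
  | nil, _ => ∅
  | cons c s, a => (insert [] (words c 0)).image (List.cons a) ∪ words s (a + 1)

/-- The words of the forest together with their offspring numbers. -/
def offspring : Forest → ℕ → List (List ℕ × ℕ)
  | nil, _ => []
  | cons c s, a => (([], c.len) :: offspring c 0).map (fun x => (a :: x.1, x.2)) ++
      offspring s (a + 1)

/-- The offspring numbers `ω` produce the forest, with first root `[a]`. -/
def Fits : Forest → ℕ → (List ℕ → ℕ) → Prop
  | nil, _, _ => True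
  | cons c s, a, ω => ω [a] = c.len ∧ Fits c 0 (fun v => ω (a :: v)) ∧ Fits s (a + 1) ω

theorem fits_iff (f : Forest) (a : ℕ) (ω : List ℕ → ℕ) :
    f.Fits a ω ↔ ∀ x ∈ f.offspring a, ω x.1 = x.2 := by
  induction f generalizing a ω with
  | nil => simp [Fits, offspring]
  | cons c s ihc ihs =>
    simp only [Fits, ihc, ihs, offspring, List.mem_append, List.mem_map, List.mem_cons]
    constructor
    · rintro ⟨h1, h2, h3⟩ x (⟨y, rfl | hy, rfl⟩ | hx)
      · exact h1
      · exact h2 y hy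
      · exact h3 x hx
    · intro h
      exact ⟨h _ (Or.inl ⟨([], c.len), Or.inl rfl, rfl⟩),
        fun x hx => h _ (Or.inl ⟨x, Or.inr hx, rfl⟩), fun x hx => h _ (Or.inr hx)⟩

theorem exists_cons_of_mem_offspring (f : Forest) (a : ℕ) (x : List ℕ × ℕ)
    (hx : x ∈ f.offspring a) : ∃ b v, a ≤ b ∧ x.1 = b :: v := by
  induction f generalizing a with
  | nil => simp [offspring] at hx
  | cons c s _ ihs =>
    simp only [offspring, List.mem_append, List.mem_map] at hx
    rcases hx with ⟨y, _, rfl⟩ | hx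
    · exact ⟨a, y.1, le_rfl, rfl⟩
    · obtain ⟨b, v, hb, h⟩ := ihs (a + 1) hx
      exact ⟨b, v, by omega, h⟩

theorem nodup_offspring (f : Forest) (a : ℕ) : ((f.offspring a).map Prod.fst).Nodup := by
  induction f generalizing a with
  | nil => simp [offspring]
  | cons c s ihc ihs =>
    rw [offspring, List.map_append, List.nodup_append]
    refine ⟨?_, ihs _, ?_⟩
    · rw [List.map_map]
      have h : (Prod.fst ∘ fun x : List ℕ × ℕ => (a :: x.1, x.2)) = List.cons a ∘ Prod.fst := rfl
      rw [h, ← List.map_map]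
      refine List.Nodup.map (List.cons_injective) ?_
      rw [List.map_cons, List.nodup_cons]
      refine ⟨fun h => ?_, ihc 0⟩
      obtain ⟨x, hx, h0⟩ := List.mem_map.1 h
      obtain ⟨b, v, _, hbv⟩ := exists_cons_of_mem_offspring c 0 x hx
      rw [hbv] at h0
      exact List.cons_ne_nil _ _ h0
    · intro u hu w hw huw
      obtain ⟨x, hx, rfl⟩ := List.mem_map.1 hu
      obtain ⟨y, hy, rfl⟩ := List.mem_map.1 hw
      obtain ⟨z, _, rfl⟩ := List.mem_map.1 hx
      obtain ⟨b, v, hb, hbv⟩ := exists_cons_of_mem_offspring s (a + 1) y hy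
      rw [hbv] at huw
      simp only [List.cons.injEq] at huw
      omega

theorem prod_offspring (G : ℝ≥0∞⟦X⟧) (f : Forest) (a : ℕ) :
    ((f.offspring a).map fun x => coeff x.2 G).prod = f.weight G := by
  induction f generalizing a with
  | nil => simp [offspring, weight]
  | cons c s ihc ihs =>
    have := ihc 0
    simp only [offspring, List.map_append, List.prod_append, ihs, weight, List.map_map,
      List.map_cons, List.prod_cons]
    rw [← this]
    rfl

theorem mem_words_cons (c s : Forest) (a b : ℕ) (u : List ℕ) :
    b :: u ∈ (cons c s).words a ↔ (b = a ∧ u ∈ insert [] (c.words 0)) ∨ b :: u ∈ s.words (a + 1) := by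
  rw [words, Finset.mem_union, Finset.mem_image]
  refine or_congr_left ⟨?_, ?_⟩
  · rintro ⟨v, hv, h⟩
    simp only [List.cons.injEq] at h
    exact ⟨h.1.symm, h.2 ▸ hv⟩
  · rintro ⟨rfl, hu⟩
    exact ⟨u, hu, rfl⟩

theorem exists_cons_of_mem_words (f : Forest) (a : ℕ) {w : List ℕ} (hw : w ∈ f.words a) :
    ∃ b v, a ≤ b ∧ w = b :: v := by
  induction f generalizing a with
  | nil => simp [words] at hw
  | cons c s _ ihs =>
    rw [words, Finset.mem_union, Finset.mem_image] at hw
    rcases hw with ⟨y, _, rfl⟩ | hx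
    · exact ⟨a, y, le_rfl, rfl⟩
    · obtain ⟨b, v, hb, h⟩ := ihs (a + 1) hx
      exact ⟨b, v, by omega, h⟩

theorem nil_notMem_words (f : Forest) (a : ℕ) : [] ∉ f.words a := by
  intro h
  obtain ⟨b, v, _, h⟩ := exists_cons_of_mem_words f a h
  exact List.cons_ne_nil _ _ h.symm

theorem disjoint_words (c s : Forest) (a : ℕ) :
    Disjoint ((insert [] (c.words 0)).image (List.cons a)) (s.words (a + 1)) := by
  rw [Finset.disjoint_left]
  intro w hw hw'
  obtain ⟨y, _, rfl⟩ := Finset.mem_image.1 hw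
  obtain ⟨b, v, hb, h⟩ := exists_cons_of_mem_words s (a + 1) hw'
  simp only [List.cons.injEq] at h
  omega

theorem card_words (f : Forest) (a : ℕ) : (f.words a).card = f.size := by
  induction f generalizing a with
  | nil => rfl
  | cons c s ihc ihs =>
    rw [words, Finset.card_union_of_disjoint (disjoint_words c s a),
      Finset.card_image_of_injective _ List.cons_injective,
      Finset.card_insert_of_notMem (nil_notMem_words c 0), ihc, ihs, size]
    omega

theorem Fits.mem_words {f : Forest} {a : ℕ} {ω : List ℕ → ℕ} (h : f.Fits a ω) (b : ℕ)
    (u : List ℕ) : b :: u ∈ f.words a ↔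
      a ≤ b ∧ b < a + f.len ∧ u ∈ familyTree fun v => ω (b :: v) := by
  induction f generalizing a ω b u with
  | nil => simp only [words, Finset.notMem_empty, len, false_iff]; omega
  | cons c s ihc ihs =>
    obtain ⟨h1, h2, h3⟩ := h
    rw [mem_words_cons, ihs h3, len]
    by_cases hab : b = a
    · subst hab
      have : u ∈ insert [] (c.words 0) ↔ u ∈ familyTree fun v => ω (b :: v) := by
        cases u with
        | nil => simp [nil_mem_familyTree]
        | cons d u => rw [Finset.mem_insert, ihc h2, cons_mem_familyTree, h1]; simp
      rw [this]
      simp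
    · simp only [hab, false_and, false_or]
      have e1 : a + 1 ≤ b ↔ a ≤ b := by omega
      rw [e1, show a + 1 + s.len = a + (s.len + 1) by ring]

/-- The event that the family tree is the tree whose root has the subtrees `c`. -/
def event (c : Forest) : Set (List ℕ → ℕ) := {ω | ω [] = c.len ∧ c.Fits 0 ω}

theorem familyTree_eq_of_mem_event {c : Forest} {ω : List ℕ → ℕ} (h : ω ∈ c.event) :
    familyTree ω = (insert [] (c.words 0) : Finset (List ℕ)) := by
  ext u
  rw [Finset.mem_coe, Finset.mem_insert]
  cases u with
  | nil => simp [nil_mem_familyTree]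
  | cons b u => rw [h.2.mem_words, cons_mem_familyTree, h.1]; simp

theorem encard_familyTree_of_mem_event {c : Forest} {ω : List ℕ → ℕ} (h : ω ∈ c.event) :
    (familyTree ω).encard = (c.size + 1 : ℕ) := by
  rw [familyTree_eq_of_mem_event h, Set.encard_coe_eq_coe_finsetCard,
    Finset.card_insert_of_notMem (nil_notMem_words c 0), card_words]

theorem Fits.unique {f g : Forest} {a : ℕ} {ω : List ℕ → ℕ} (hf : f.Fits a ω) (hg : g.Fits a ω)
    (h : f.len = g.len) : f = g := by
  induction f generalizing g a ω with
  | nil =>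
    cases g with
    | nil => rfl
    | cons => simp [len] at h
  | cons c s ihc ihs =>
    cases g with
    | nil => simp [len] at h
    | cons c' s' =>
      rw [ihc hf.2.1 hg.2.1 (hf.1.symm.trans hg.1), ihs hf.2.2 hg.2.2 (by simpa [len] using h)]

theorem event_disjoint {c c' : Forest} (h : c ≠ c') : Disjoint c.event c'.event :=
  Set.disjoint_left.2 fun _ h1 h2 => h (h1.2.unique h2.2 (h1.1.symm.trans h2.1))

/-- Induction on a bound for the number of vertices. Without the vertex `[a]`, its descendants and
the branches of its later siblings each have at most `n` vertices, and they supply the two arguments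
of `cons`. -/
theorem exists_fits (n : ℕ) : ∀ (ω : List ℕ → ℕ) (a : ℕ),
    {w ∈ familyTree ω | ∃ b v, a ≤ b ∧ w = b :: v}.encard ≤ n →
    ∃ f : Forest, f.len = ω [] - a ∧ f.Fits a ω := by
  induction n with
  | zero =>
    intro ω a h
    refine ⟨nil, ?_, trivial⟩
    rw [Nat.cast_zero, nonpos_iff_eq_zero, Set.encard_eq_zero] at h
    by_contra hne
    have h1 : [a] ∈ familyTree ω := by
      rw [cons_mem_familyTree]
      refine ⟨?_, nil_mem_familyTree _⟩
      simp only [len] at hne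
      omega
    have h2 : [a] ∈ {w ∈ familyTree ω | ∃ b v, a ≤ b ∧ w = b :: v} :=
      ⟨h1, a, [], le_rfl, rfl⟩
    rw [h] at h2
    exact h2
  | succ n ih =>
    intro ω a h
    rcases Nat.lt_or_ge a (ω []) with ha | ha
    swap
    · exact ⟨nil, by simp only [len]; omega, trivial⟩
    have h1 : [a] ∈ {w ∈ familyTree ω | ∃ b v, a ≤ b ∧ w = b :: v} :=
      ⟨(cons_mem_familyTree ω a []).2 ⟨ha, nil_mem_familyTree _⟩, a, [], le_rfl, rfl⟩
    have h2 : ({w ∈ familyTree ω | ∃ b v, a ≤ b ∧ w = b :: v} \ {[a]}).encard ≤ n := by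
      rw [← Set.encard_sdiff_singleton_add_one h1] at h
      push_cast at h
      exact (ENat.add_le_add_iff_right ENat.one_ne_top).1 h
    obtain ⟨c, hc1, hc2⟩ := ih (fun v => ω (a :: v)) 0 (by
      rw [← (List.cons_injective (a := a)).encard_image]
      refine le_trans (Set.encard_le_encard ?_) h2
      rintro _ ⟨w, ⟨hw, b, v, _, rfl⟩, rfl⟩
      exact ⟨⟨(cons_mem_familyTree ω a _).2 ⟨ha, hw⟩, a, _, le_rfl, rfl⟩, by simp⟩)
    obtain ⟨s, hs1, hs2⟩ := ih ω (a + 1) (by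
      refine le_trans (Set.encard_le_encard ?_) h2
      rintro _ ⟨hw, b, v, hb, rfl⟩
      refine ⟨⟨hw, b, v, by omega, rfl⟩, ?_⟩
      simp only [Set.mem_singleton_iff, List.cons.injEq]
      omega)
    exact ⟨cons c s, by rw [len, hs1]; omega, by rw [hc1]; rfl, hc2, hs2⟩

theorem sizeEvent_eq (n : ℕ) :
    sizeEvent n = ⋃ c : Forest, if c.size + 1 = n then c.event else ∅ := by
  ext ω
  rw [Set.mem_iUnion]
  constructor
  · intro h
    have h' : (familyTree ω).encard = n := h
    obtain ⟨c, hc1, hc2⟩ := exists_fits n ω 0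
      ((Set.encard_le_encard (Set.sep_subset _ _)).trans h'.le)
    have hc : ω ∈ c.event := ⟨by rw [hc1]; rfl, hc2⟩
    refine ⟨c, ?_⟩
    rw [encard_familyTree_of_mem_event hc] at h'
    rw [if_pos (by exact_mod_cast h')]
    exact hc
  · rintro ⟨c, hc⟩
    split_ifs at hc with h
    · exact (encard_familyTree_of_mem_event hc).trans (by rw [h])
    · exact absurd hc (Set.notMem_empty _)

/-- An injective numbering of the finite forests. -/
def code : Forest → ℕ
  | nil => 0
  | cons c s => Nat.pair c.code s.code + 1

theorem code_injective : Function.Injective code := by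
  intro f
  induction f with
  | nil => intro g h; cases g <;> simp_all [code]
  | cons c s ihc ihs =>
    intro g h
    cases g with
    | nil => simp [code] at h
    | cons c' s' =>
      simp only [code, Nat.add_right_cancel_iff, Nat.pair_eq_pair] at h
      rw [ihc h.1, ihs h.2]

instance instCountable : Countable Forest := code_injective.countable

end Forest

/-! ### Probabilities of finite trees under the offspring law. -/

/-- The generating function of the offspring distribution. -/
noncomputable def offspringGF (p : PMF ℕ) : ℝ≥0∞⟦X⟧ := PowerSeries.mk p

theorem offspringLaw_cylinder (p : PMF ℕ) (L : List (List ℕ × ℕ)) (hL : (L.map Prod.fst).Nodup) :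
    MeasurableSet {ω : List ℕ → ℕ | ∀ x ∈ L, ω x.1 = x.2} ∧
    offspringLaw p {ω | ∀ x ∈ L, ω x.1 = x.2} = (L.map fun x => p x.2).prod := by
  have hset : {ω : List ℕ → ℕ | ∀ x ∈ L, ω x.1 = x.2} =
      Set.pi ((L.map Prod.fst).toFinset : Set (List ℕ)) fun v => {i | ∀ x ∈ L, x.1 = v → i = x.2} := by
    ext ω
    simp only [Set.mem_ofPred_eq, Set.mem_pi, List.coe_toFinset, List.mem_map]
    constructor
    · rintro h v - x hx rfl
      exact h x hx
    · intro h x hx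
      exact h x.1 ⟨x, hx, rfl⟩ x hx rfl
  refine ⟨?_, ?_⟩
  · rw [hset]
    exact MeasurableSet.pi (Finset.countable_toSet _) fun _ _ => MeasurableSet.of_discrete
  · rw [hset, offspringLaw, Measure.infinitePi_pi _ fun _ _ => MeasurableSet.of_discrete,
      List.prod_toFinset _ hL, List.map_map]
    congr 1
    refine List.map_congr_left fun x hx => ?_
    have : {i | ∀ y ∈ L, y.1 = x.1 → i = y.2} = {x.2} := by
      ext i
      simp only [Set.mem_ofPred_eq, Set.mem_singleton_iff]
      constructor
      · intro h; exact h x hx rfl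
      · rintro rfl y hy hyx
        rw [List.inj_on_of_nodup_map hL hy hx hyx]
    rw [Function.comp_apply, this, PMF.toMeasure_apply_singleton _ _ (MeasurableSet.singleton _)]

theorem event_measure (p : PMF ℕ) (c : Forest) : MeasurableSet c.event ∧
    offspringLaw p c.event = coeff c.len (offspringGF p) * c.weight (offspringGF p) := by
  have h := offspringLaw_cylinder p (([], c.len) :: c.offspring 0) (by
    rw [List.map_cons, List.nodup_cons]
    refine ⟨fun h => ?_, nodup_offspring c 0⟩
    obtain ⟨x, hx, h0⟩ := List.mem_map.1 h
    obtain ⟨b, v, _, hbv⟩ := exists_cons_of_mem_offspring c 0 x hx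
    rw [hbv] at h0
    exact List.cons_ne_nil _ _ h0)
  have hset : {ω : List ℕ → ℕ | ∀ x ∈ ([], c.len) :: c.offspring 0, ω x.1 = x.2} = c.event := by
    ext ω
    simp [event, fits_iff]
  rw [hset] at h
  refine ⟨h.1, h.2.trans ?_⟩
  rw [List.map_cons, List.prod_cons, ← prod_offspring _ c 0]
  simp [offspringGF]

/-- The size event is a countable disjoint union of cylinders on which the tree is fixed. As `F` is
constant on each, no measurability of `F` is needed. -/
theorem setLIntegral_sizeEvent (p : PMF ℕ) (n : ℕ) (F : (List ℕ → ℕ) → ℝ≥0∞) (α : Forest → ℝ≥0∞)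
    (h : ∀ c : Forest, ∀ ω ∈ c.event, F ω = α c) :
    ∫⁻ ω in sizeEvent n, F ω ∂(offspringLaw p) = coeff n (treeGF (offspringGF p) α) := by
  rw [sizeEvent_eq, lintegral_iUnion]
  · rw [treeGF, coeff_mk]
    refine tsum_congr fun c => ?_
    split_ifs with hc
    · rw [setLIntegral_congr_fun (event_measure p c).1 (h c), setLIntegral_const,
        (event_measure p c).2, mul_comm]
    · simp
  · intro c
    split_ifs
    · exact (event_measure p c).1
    · exact MeasurableSet.empty
  · intro c c' hcc
    dsimp only [Function.onFun]
    split_ifs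
    · exact event_disjoint hcc
    all_goals simp

theorem offspringLaw_sizeEvent (p : PMF ℕ) (n : ℕ) :
    offspringLaw p (sizeEvent n) = coeff n (treeGF (offspringGF p) fun _ => 1) := by
  rw [← setLIntegral_sizeEvent p n (fun _ => 1) (fun _ => 1) fun _ _ _ => rfl, setLIntegral_one]

theorem isCritical_offspringGF (p : PMF ℕ) (hmean : ∫ i : ℕ, (i : ℝ) ∂p.toMeasure = 1)
    (hvar_pos : 0 < evariance (fun i : ℕ => (i : ℝ)) p.toMeasure)
    (hvar_fin : evariance (fun i : ℕ => (i : ℝ)) p.toMeasure < ⊤) :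
    IsCritical (offspringGF p) := by
  have hl : ∀ φ : ℕ → ℝ≥0∞, wsum (offspringGF p) φ = ∫⁻ i, φ i ∂p.toMeasure := by
    intro φ
    rw [lintegral_countable']
    refine tsum_congr fun i => ?_
    rw [PMF.toMeasure_apply_singleton _ _ (MeasurableSet.singleton _), offspringGF, coeff_mk,
      mul_comm]
  have hmass : wsum (offspringGF p) 1 = 1 := by rw [hl]; simp
  have hm : wsum (offspringGF p) (fun n => (n : ℝ≥0∞)) = 1 := by
    have hint : Integrable (fun i : ℕ => (i : ℝ)) p.toMeasure := by
      -- The integral of a nonintegrable function is `0` by convention, so mean one forces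
      -- integrability.
      by_contra h
      rw [integral_undef h] at hmean
      exact zero_ne_one hmean
    have := ofReal_integral_eq_lintegral_ofReal hint (ae_of_all _ fun i => by positivity)
    rw [hmean, ENNReal.ofReal_one] at this
    rw [hl, this]
    simp
  have hv : wsum (offspringGF p) (fun n => ENNReal.ofReal (((n : ℝ) - 1) ^ 2)) =
      evariance (fun i : ℕ => (i : ℝ)) p.toMeasure := by
    rw [hl, evariance, hmean]
    refine lintegral_congr fun i => ?_
    rw [← ofReal_norm, ← ENNReal.ofReal_pow (norm_nonneg _), Real.norm_eq_abs, sq_abs]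
  have hex : ∃ i ≠ 1, coeff i (offspringGF p) ≠ 0 := by
    by_contra hcon
    push Not at hcon
    refine hvar_pos.ne' ?_
    rw [← hv, wsum]
    refine ENNReal.tsum_eq_zero.2 fun i => ?_
    by_cases hi : i = 1
    · simp [hi]
    · simp [hcon i hi]
  -- A law on `{0, 1}` with mean one is the point mass at one, which the positive variance excludes.
  have hlarge : ∃ r ≥ 2, coeff r (offspringGF p) ≠ 0 := by
    by_contra hcon
    push Not at hcon
    have h1 : coeff 1 (offspringGF p) = 1 := by
      rw [← hm, wsum, tsum_eq_single 1]
      · simp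
      · intro i hi
        rcases Nat.lt_or_ge i 2 with h | h
        · obtain rfl : i = 0 := by omega
          simp
        · simp [hcon i h]
    obtain ⟨i, hi1, hi⟩ := hex
    rcases Nat.lt_or_ge i 2 with h | h
    · obtain rfl : i = 0 := by omega
      have h2 : coeff 0 (offspringGF p) + coeff 1 (offspringGF p) ≤ 1 := by
        rw [← hmass, wsum]
        refine le_trans (le_of_eq ?_) (ENNReal.sum_le_tsum (Finset.range 2))
        simp [Finset.sum_range_succ]
      rw [h1] at h2
      have h3 : coeff 0 (offspringGF p) + 1 ≤ 0 + 1 := by simpa using h2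
      exact hi (nonpos_iff_eq_zero.1 ((ENNReal.add_le_add_iff_right ENNReal.one_ne_top).1 h3))
    · exact hi (hcon i h)
  refine ⟨hmass, hm, ?_, ?_, hlarge⟩
  · have h1 := congrArg (wsum (offspringGF p)) (funext fun n => ofReal_sub_sq_add n 1)
    simp only [wsum_add_right, wsum_mul_left, hm, wsum_const, hmass, Nat.cast_one, hv] at h1
    have h2 : wsum (offspringGF p) (fun n => (n : ℝ≥0∞) ^ 2) ≤
        evariance (fun i : ℕ => (i : ℝ)) p.toMeasure + 2 * 1 * 1 := by
      rw [h1]; exact le_self_add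
    exact ne_top_of_le_ne_top (by finiteness) h2
  · intro h0
    obtain ⟨r, hr, hr0⟩ := hlarge
    -- Without an atom at zero, `i ≥ 1 + 1_{i = r}` almost surely, and the mean would exceed one.
    have hle : ∀ i, coeff i (offspringGF p) * 1 +
        coeff i (offspringGF p) * (if i = r then 1 else 0) ≤ coeff i (offspringGF p) * i := by
      intro i
      rw [← mul_add]
      rcases Nat.eq_zero_or_pos i with rfl | hi
      · simp [h0]
      · gcongr
        split_ifs with h
        · subst h; exact_mod_cast hr
        · rw [add_zero]; exact_mod_cast hi
    have h1 := ENNReal.tsum_le_tsum hle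
    rw [ENNReal.tsum_add] at h1
    change wsum (offspringGF p) 1 + wsum (offspringGF p) (fun i => if i = r then 1 else 0) ≤
      wsum (offspringGF p) _ at h1
    rw [hm, hmass, ← coeff_eq_wsum] at h1
    have h2 : 1 + coeff r (offspringGF p) ≤ 1 + 0 := by simpa using h1
    exact hr0 (nonpos_iff_eq_zero.1 ((ENNReal.add_le_add_iff_left ENNReal.one_ne_top).1 h2))

end GaltonWatson

/-! ### Distances and paths through the root. -/

namespace GaltonWatson
open Finset.HasAntidiagonal
open Forest

section Graph

theorem mem_familyTree_of_append {ω : List ℕ → ℕ} {u v : List ℕ} (h : u ++ v ∈ familyTree ω) :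
    u ∈ familyTree ω := fun x i hx => h x i (hx.trans (List.prefix_append u v))

variable {ω : List ℕ → ℕ}

/-- The root of the family tree. -/
abbrev rootVertex (ω : List ℕ → ℕ) : familyTree ω := ⟨[], nil_mem_familyTree ω⟩

/-- Two vertices in different branches at the root are at distance at least the sum of their
heights. -/
theorem length_add_length_le_walk_length {v w : familyTree ω} (h : v.1.head? ≠ w.1.head?)
    (P : (ulamHarris.induce (familyTree ω)).Walk v w) :
    v.1.length + w.1.length ≤ P.length := by
  -- A signed height, negative on the branch of `v`. It vanishes at the root and changes by at most
  -- one along an edge, so a walk from `v` to `w` needs as many steps as `g` rises.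
  let g : List ℕ → ℤ := fun x => if x.head? = v.1.head? then -x.length else x.length
  have hstep : ∀ x i, g (x ++ [i]) ≤ g x + 1 ∧ g x ≤ g (x ++ [i]) + 1 := by
    intro x i
    cases x with
    | nil => simp only [g, List.nil_append, List.length_nil, List.length_singleton]; split_ifs <;> simp
    | cons a x =>
      simp only [g, List.cons_append, List.head?_cons, List.length_cons, List.length_append,
        List.length_nil]
      by_cases ha : some a = v.1.head? <;> simp only [ha, if_true, if_false] <;> push_cast <;>
        constructor <;> linarith
  have hwalk : ∀ (x y : familyTree ω) (Q : (ulamHarris.induce (familyTree ω)).Walk x y),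
      g y.1 ≤ g x.1 + Q.length := by
    intro x y Q
    induction Q with
    | nil => simp
    | @cons x y z hadj Q ih =>
      rw [SimpleGraph.Walk.length_cons]
      have hadj' := SimpleGraph.induce_adj.1 hadj
      rcases hadj' with ⟨i, hi⟩ | ⟨i, hi⟩
      · have := (hstep x.1 i).1
        rw [← hi] at this
        push_cast; linarith
      · have := (hstep y.1 i).2
        rw [← hi] at this
        push_cast; linarith
  have h1 := hwalk v w P
  simp only [g, if_pos, if_neg (Ne.symm h)] at h1
  omega

theorem exists_walk_root (v : familyTree ω) :
    ∃ P : (ulamHarris.induce (familyTree ω)).Walk v (rootVertex ω), P.length = v.1.length := by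
  obtain ⟨v, hv⟩ := v
  induction v using List.reverseRecOn with
  | nil => exact ⟨SimpleGraph.Walk.nil, rfl⟩
  | append_singleton u i ih =>
    obtain ⟨P, hP⟩ := ih (mem_familyTree_of_append hv)
    have hadj : (ulamHarris.induce (familyTree ω)).Adj ⟨u ++ [i], hv⟩
        ⟨u, mem_familyTree_of_append hv⟩ := SimpleGraph.induce_adj.2 (Or.inr ⟨i, rfl⟩)
    exact ⟨SimpleGraph.Walk.cons hadj P, by simp [hP]⟩

/-- A walk leaving the branch of a child of the root passes through that child. -/
theorem exists_mem_support_singleton {a : ℕ} {v w : familyTree ω}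
    (P : (ulamHarris.induce (familyTree ω)).Walk v w) (hv : v.1.head? = some a)
    (hw : w.1.head? ≠ some a) : ∃ x ∈ P.support, x.1 = [a] := by
  induction P with
  | nil => exact absurd hv hw
  | @cons x y z hadj P ih =>
    rw [SimpleGraph.Walk.support_cons]
    by_cases hy : y.1.head? = some a
    · obtain ⟨x, hx, hxa⟩ := ih hy hw
      exact ⟨x, List.mem_cons_of_mem _ hx, hxa⟩
    · refine ⟨x, List.mem_cons_self, ?_⟩
      rcases SimpleGraph.induce_adj.1 hadj with ⟨i, hi⟩ | ⟨i, hi⟩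
      · rw [hi] at hy
        cases hx : x.1 with
        | nil => rw [hx] at hv; simp at hv
        | cons b u => rw [hx] at hv hy; simp at hv hy; exact absurd hv hy
      · cases hyu : y.1 with
        | nil => rw [hi, hyu] at hv; rw [hi, hyu]; simpa using hv
        | cons b u => rw [hi, hyu] at hv; rw [hyu] at hy; simp at hv hy; exact absurd hv hy

theorem dist_eq_and_path_through_root_iff {k : ℕ} (hk : 1 ≤ k) (v w : familyTree ω) :
    ((ulamHarris.induce (familyTree ω)).dist v w = k ∧
      ∃ P : (ulamHarris.induce (familyTree ω)).Walk v w, P.IsPath ∧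
        ∃ r ∈ P.support, (r : List ℕ) = []) ↔
    v.1.length + w.1.length = k ∧ v.1.head? ≠ w.1.head? := by
  have key : v.1.head? ≠ w.1.head? →
      (ulamHarris.induce (familyTree ω)).dist v w = v.1.length + w.1.length ∧
      ∃ P : (ulamHarris.induce (familyTree ω)).Walk v w, P.IsPath ∧
        ∃ r ∈ P.support, (r : List ℕ) = [] := by
    intro h
    obtain ⟨P, hP⟩ := exists_walk_root v
    obtain ⟨Q, hQ⟩ := exists_walk_root w
    have hlen : (P.append Q.reverse).length = v.1.length + w.1.length := by
      rw [SimpleGraph.Walk.length_append, SimpleGraph.Walk.length_reverse, hP, hQ]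
    have hd : (ulamHarris.induce (familyTree ω)).dist v w = v.1.length + w.1.length := by
      refine le_antisymm (hlen ▸ SimpleGraph.dist_le _) ?_
      obtain ⟨R, hR⟩ := SimpleGraph.Reachable.exists_walk_length_eq_dist ⟨P.append Q.reverse⟩
      rw [← hR]
      exact length_add_length_le_walk_length h R
    refine ⟨hd, P.append Q.reverse, SimpleGraph.Walk.isPath_of_length_eq_dist _ (hlen.trans hd.symm),
      rootVertex ω, ?_, rfl⟩
    rw [SimpleGraph.Walk.mem_support_append_iff]
    exact Or.inl P.end_mem_support
  constructor
  · rintro ⟨hd, P, hP, r, hr, hr0⟩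
    have hne : v.1.head? ≠ w.1.head? := by
      -- Two vertices with no first letter are both the root, at distance `0 < k`. If both lie in
      -- the branch of `[a]`, the path visits `[a]` before and after the root, which a path cannot
      -- do.
      intro heq
      cases hv : v.1.head? with
      | none =>
        have hvw : v = w := by
          rw [hv] at heq
          rw [List.head?_eq_none_iff] at hv
          exact Subtype.ext (hv.trans (List.head?_eq_none_iff.1 heq.symm).symm)
        rw [hvw, SimpleGraph.dist_self] at hd
        omega
      | some a =>
        have hra : r.1.head? ≠ some a := by rw [hr0]; simp
        obtain ⟨x, hx, hxa⟩ := exists_mem_support_singleton (P.takeUntil r hr) hv hra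
        obtain ⟨y, hy, hya⟩ := exists_mem_support_singleton (P.dropUntil r hr).reverse
          (heq ▸ hv) hra
        obtain rfl : x = y := Subtype.ext (hxa.trans hya.symm)
        rw [SimpleGraph.Walk.support_reverse, List.mem_reverse] at hy
        have hnd := hP.support_nodup
        rw [← P.take_spec hr, SimpleGraph.Walk.support_append, List.nodup_append] at hnd
        rw [← SimpleGraph.Walk.cons_tail_support, List.mem_cons] at hy
        rcases hy with hy | hy
        · rw [hy, hr0] at hxa; exact absurd hxa (by simp)
        · exact hnd.2.2 x hx x hy rfl
    exact ⟨(key hne).1.symm.trans hd, hne⟩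
  · rintro ⟨h1, h2⟩
    obtain ⟨h3, h4⟩ := key h2
    exact ⟨h3.trans h1, h4⟩

end Graph

/-- The branch of a vertex at the root, with `0` for the root itself. -/
def branch : List ℕ → ℕ
  | [] => 0
  | a :: _ => a + 1

theorem head?_ne_iff (v w : List ℕ) : v.head? ≠ w.head? ↔ branch v ≠ branch w := by
  cases v <;> cases w <;> simp [branch]

/-- Ordered pairs in different branches with heights summing up to `k`. -/
def branchPairs (T : Finset (List ℕ)) (k : ℕ) : Finset (List ℕ × List ℕ) :=
  (T ×ˢ T).filter fun x => x.1.length + x.2.length = k ∧ branch x.1 < branch x.2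

/-- The two vertices lie in different branches, so ordering the branches selects exactly one
orientation of each unordered pair. -/
theorem pairsThroughRoot_eq_card {ω : List ℕ → ℕ} {T : Finset (List ℕ)} (hT : familyTree ω = T)
    {k : ℕ} (hk : 1 ≤ k) : pairsThroughRoot k (familyTree ω) = (branchPairs T k).card := by
  have hinj : Function.Injective (Sym2.map (Subtype.val : familyTree ω → List ℕ)) :=
    Sym2.map.injective Subtype.val_injective
  have hinj2 : Set.InjOn (fun x : List ℕ × List ℕ => s(x.1, x.2)) (branchPairs T k) := by
    rintro ⟨a, b⟩ hab ⟨c, d⟩ hcd h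
    simp only [branchPairs, Finset.coe_filter, Set.mem_ofPred_eq] at hab hcd
    rcases Sym2.eq_iff.1 h with ⟨rfl, rfl⟩ | ⟨rfl, rfl⟩
    · rfl
    · exact absurd hab.2.2 (by simpa using hcd.2.2.le)
  rw [pairsThroughRoot, ← Set.ncard_image_of_injective _ hinj, ← Set.ncard_coe_finset,
    ← hinj2.ncard_image]
  congr 1
  have hmem : ∀ x, x ∈ T ↔ x ∈ familyTree ω := by intro x; rw [hT]; rfl
  ext s
  simp only [Set.mem_image, Set.mem_ofPred_eq, branchPairs, Finset.coe_filter, Finset.mem_product,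
    hmem]
  constructor
  · rintro ⟨_, ⟨v, w, rfl, h⟩, rfl⟩
    rw [dist_eq_and_path_through_root_iff hk, head?_ne_iff] at h
    rcases lt_or_gt_of_ne h.2 with hlt | hlt
    · exact ⟨(v, w), ⟨⟨v.2, w.2⟩, h.1, hlt⟩, rfl⟩
    · exact ⟨(w, v), ⟨⟨w.2, v.2⟩, by rw [add_comm]; exact h.1, hlt⟩, Sym2.eq_swap⟩
  · rintro ⟨⟨v, w⟩, ⟨⟨hv, hw⟩, h1, h2⟩, rfl⟩
    refine ⟨s(⟨v, hv⟩, ⟨w, hw⟩), ⟨⟨v, hv⟩, ⟨w, hw⟩, rfl, ?_⟩, rfl⟩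
    rw [dist_eq_and_path_through_root_iff hk, head?_ne_iff]
    exact ⟨h1, h2.ne⟩

namespace Forest

theorem card_words_filter_length (f : Forest) (a i : ℕ) :
    ((f.words a).filter fun w => w.length = i + 1).card = f.level i := by
  induction f generalizing a i with
  | nil => rfl
  | cons c s ihc ihs =>
    rw [words, Finset.filter_union, Finset.card_union_of_disjoint
      (Finset.disjoint_filter_filter (disjoint_words c s a)), ihs, level_cons, Finset.filter_image,
      Finset.card_image_of_injective _ List.cons_injective]
    congr 1
    cases i with
    | zero =>
      rw [treeLevel, Finset.card_eq_one]
      refine ⟨[], ?_⟩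
      ext w
      simp only [Finset.mem_filter, Finset.mem_insert, Finset.mem_singleton, List.length_cons]
      constructor
      · rintro ⟨_, h⟩
        exact List.length_eq_zero_iff.1 (by omega)
      · rintro rfl; simp
    | succ i =>
      rw [treeLevel, ← ihc 0 i, Finset.filter_insert, if_neg (by simp)]
      congr 1
      ext w
      simp

theorem card_treeWords_filter_length (c : Forest) (i : ℕ) :
    ((insert [] (c.words 0)).filter fun w => w.length = i).card = c.treeLevel i := by
  have := card_words_filter_length (cons c nil) 0 i
  rw [words, words, Finset.union_empty, Finset.filter_image,
    Finset.card_image_of_injective _ List.cons_injective, level_cons] at this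
  simpa [level] using this

/-- First letters increase from one tree to the next, so an ordered pair either starts in the first
tree and ends in a later one, or avoids the first tree. The shift by two arises because height `i`
in the forest means word length `i + 1`. -/
theorem card_branchPairs_words (f : Forest) (a l : ℕ) :
    (branchPairs (f.words a) (l + 2)).card = f.crossPairs l := by
  induction f generalizing a with
  | nil => rfl
  | cons c s _ ihs =>
    have hsplit : branchPairs ((cons c s).words a) (l + 2) =
        ((antidiagonal l).biUnion fun x =>
          (((insert [] (c.words 0)).filter fun w => w.length = x.1).image (List.cons a)) ×ˢ
            ((s.words (a + 1)).filter fun w => w.length = x.2 + 1)) ∪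
        branchPairs (s.words (a + 1)) (l + 2) := by
      ext ⟨v, w⟩
      simp only [branchPairs, Finset.mem_filter, Finset.mem_product, Finset.mem_union,
        Finset.mem_biUnion, mem_antidiagonal, Finset.mem_image]
      constructor
      · rintro ⟨⟨hv, hw⟩, hl, hb⟩
        rw [words, Finset.mem_union, Finset.mem_image] at hv hw
        rcases hv with ⟨v, hv, rfl⟩ | hv
        · rcases hw with ⟨w, hw, rfl⟩ | hw
          · simp [branch] at hb
          · left
            obtain ⟨b, w, hb', rfl⟩ := exists_cons_of_mem_words s (a + 1) hw
            simp only [List.length_cons] at hl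
            exact ⟨(v.length, w.length), by dsimp only; omega, ⟨v, ⟨hv, rfl⟩, rfl⟩, hw, rfl⟩
        · obtain ⟨b, v, hb', rfl⟩ := exists_cons_of_mem_words s (a + 1) hv
          rcases hw with ⟨w, hw, rfl⟩ | hw
          · simp only [branch] at hb; omega
          · exact Or.inr ⟨⟨hv, hw⟩, hl, hb⟩
      · rintro (⟨⟨i, j⟩, hij, ⟨v, ⟨hv, hvl⟩, rfl⟩, hw, hwl⟩ | ⟨⟨hv, hw⟩, hl, hb⟩)
        · dsimp only at hij hvl hwl
          refine ⟨⟨?_, ?_⟩, ?_, ?_⟩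
          · rw [words, Finset.mem_union]; exact Or.inl (Finset.mem_image_of_mem _ hv)
          · rw [words, Finset.mem_union]; exact Or.inr hw
          · rw [List.length_cons]; omega
          · obtain ⟨b, w, hb', rfl⟩ := exists_cons_of_mem_words s (a + 1) hw
            simp only [branch]; omega
        · refine ⟨⟨?_, ?_⟩, hl, hb⟩
          · rw [words, Finset.mem_union]; exact Or.inr hv
          · rw [words, Finset.mem_union]; exact Or.inr hw
    rw [hsplit, Finset.card_union_of_disjoint, ihs, crossPairs, Finset.card_biUnion]
    · congr 1
      refine Finset.sum_congr rfl fun x _ => ?_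
      rw [Finset.card_product, Finset.card_image_of_injective _ List.cons_injective,
        card_treeWords_filter_length, card_words_filter_length]
    · rintro ⟨i, j⟩ _ ⟨i', j'⟩ _ hne
      rw [Function.onFun, Finset.disjoint_left]
      rintro ⟨v, w⟩ h1 h2
      simp only [Finset.mem_product, Finset.mem_image, Finset.mem_filter] at h1 h2
      obtain ⟨⟨v1, hv1, e1⟩, -, h1⟩ := h1
      obtain ⟨⟨v2, hv2, e2⟩, -, h2⟩ := h2
      have : v1 = v2 := List.cons_injective (e1.trans e2.symm)
      subst this
      exact hne (Prod.ext (hv1.2.symm.trans hv2.2) (by dsimp only; omega))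
    · rw [Finset.disjoint_left]
      rintro ⟨v, w⟩ h1 h2
      simp only [Finset.mem_biUnion, Finset.mem_product, Finset.mem_image] at h1
      obtain ⟨_, _, ⟨v1, _, rfl⟩, _⟩ := h1
      have h3 := (Finset.mem_product.1 (Finset.mem_filter.1 h2).1).1
      obtain ⟨b, v, hb, h4⟩ := exists_cons_of_mem_words s (a + 1) h3
      simp only [List.cons.injEq] at h4
      omega

theorem card_branchPairs_treeWords (c : Forest) {k : ℕ} (hk : 1 ≤ k) :
    (branchPairs (insert [] (c.words 0)) k).card = c.rootPairs k := by
  have hsplit : branchPairs (insert [] (c.words 0)) k =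
      (((c.words 0).filter fun w => w.length = k).image fun w => ([], w)) ∪
      branchPairs (c.words 0) k := by
    ext ⟨v, w⟩
    simp only [branchPairs, Finset.mem_filter, Finset.mem_product, Finset.mem_union,
      Finset.mem_image, Finset.mem_insert, Prod.mk.injEq]
    constructor
    · rintro ⟨⟨rfl | hv, rfl | hw⟩, hl, hb⟩
      · simp at hb
      · exact Or.inl ⟨w, ⟨hw, by simpa using hl⟩, rfl, rfl⟩
      · simp [branch] at hb
      · exact Or.inr ⟨⟨hv, hw⟩, hl, hb⟩
    · rintro (⟨w, ⟨hw, hl⟩, rfl, rfl⟩ | ⟨⟨hv, hw⟩, hl, hb⟩)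
      · refine ⟨⟨Or.inl rfl, Or.inr hw⟩, by simpa using hl, ?_⟩
        obtain ⟨b, w, _, rfl⟩ := exists_cons_of_mem_words c 0 hw
        simp [branch]
      · exact ⟨⟨Or.inr hv, Or.inr hw⟩, hl, hb⟩
  rw [hsplit, Finset.card_union_of_disjoint, rootPairs,
    Finset.card_image_of_injective _ fun x y h => (Prod.mk.inj h).2]
  · congr 1
    · obtain ⟨i, rfl⟩ : ∃ i, k = i + 1 := ⟨k - 1, by omega⟩
      exact card_words_filter_length c 0 i
    · split_ifs with h
      · obtain ⟨l, rfl⟩ : ∃ l, k = l + 2 := ⟨k - 2, by omega⟩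
        exact card_branchPairs_words c 0 l
      · rw [Finset.card_eq_zero, branchPairs, Finset.filter_eq_empty_iff]
        rintro ⟨v, w⟩ hvw ⟨hl, -⟩
        rw [Finset.mem_product] at hvw
        obtain ⟨b, v', _, e1⟩ := exists_cons_of_mem_words c 0 hvw.1
        obtain ⟨b', w', _, e2⟩ := exists_cons_of_mem_words c 0 hvw.2
        dsimp only at e1 e2 hl
        rw [e1, e2, List.length_cons, List.length_cons] at hl
        omega
  · rw [Finset.disjoint_left]
    rintro ⟨v, w⟩ h1 h2
    obtain ⟨w', _, h⟩ := Finset.mem_image.1 h1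
    have h3 := (Finset.mem_product.1 (Finset.mem_filter.1 h2).1).1
    rw [← (Prod.mk.inj h).1] at h3
    exact nil_notMem_words c 0 h3

theorem pairsThroughRoot_of_mem_event {c : Forest} {ω : List ℕ → ℕ} (h : ω ∈ c.event) {k : ℕ}
    (hk : 1 ≤ k) : pairsThroughRoot k (familyTree ω) = c.rootPairs k := by
  rw [pairsThroughRoot_eq_card (familyTree_eq_of_mem_event h) hk, card_branchPairs_treeWords c hk]

end Forest

theorem expectedPairs_eq (p : PMF ℕ) {k n : ℕ} (hk : 1 ≤ k) : expectedPairs p k n =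
    (PowerSeries.coeff n (treeGF (offspringGF p) fun _ => 1))⁻¹ *
      PowerSeries.coeff n (treeGF (offspringGF p) fun f => (f.rootPairs k : ℝ≥0∞)) := by
  rw [expectedPairs, conditionedLaw, ProbabilityTheory.cond, lintegral_smul_measure,
    offspringLaw_sizeEvent, smul_eq_mul]
  congr 1
  exact setLIntegral_sizeEvent p n _ _ fun c ω h => by rw [pairsThroughRoot_of_mem_event h hk]

end GaltonWatson

/-! ### The quotient of the two coefficients. -/

theorem theorem2p2 (p : PMF ℕ)
    (hmean : ∫ i : ℕ, (i : ℝ) ∂p.toMeasure = 1)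
    (hvar_pos : 0 < evariance (fun i : ℕ => (i : ℝ)) p.toMeasure)
    (hvar_fin : evariance (fun i : ℕ => (i : ℝ)) p.toMeasure < ⊤) :
    (∃ C : ℝ, 0 < C ∧ ∀ k n : ℕ, 1 ≤ k → 1 ≤ n →
      0 < GaltonWatson.offspringLaw p (GaltonWatson.sizeEvent n) →
      GaltonWatson.expectedPairs p k n ≤ ENNReal.ofReal (C * k * √(n : ℝ))) ∧
    (∀ a b : ℝ, 0 < a → a ≤ b → ∃ c : ℝ, 0 < c ∧ ∃ N : ℕ, ∀ k n : ℕ, N ≤ n →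
      0 < GaltonWatson.offspringLaw p (GaltonWatson.sizeEvent n) →
      a * √(n : ℝ) ≤ k → (k : ℝ) ≤ b * √(n : ℝ) →
      ENNReal.ofReal (c * k * √(n : ℝ)) ≤ GaltonWatson.expectedPairs p k n) := by
  have hG := GaltonWatson.isCritical_offspringGF p hmean hvar_pos hvar_fin
  constructor
  · obtain ⟨C, hC, hup⟩ := hG.exists_coeff_rootPairs_le
    obtain ⟨c, hc, hlo⟩ := hG.exists_le_coeff_treeGF
    refine ⟨C / c, by positivity, fun k n hk hn hpos => ?_⟩
    have hn0 : (0 : ℝ) < n := by exact_mod_cast hn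
    have hs0 : 0 < √(n : ℝ) := by positivity
    rw [GaltonWatson.offspringLaw_sizeEvent] at hpos
    rw [GaltonWatson.expectedPairs_eq p hk]
    -- Numerator of order `k/n` over denominator of order `n^(-3/2)`.
    calc _ ≤ (ENNReal.ofReal (c / (n * √(n : ℝ))))⁻¹ * ENNReal.ofReal (C * k / n) :=
          mul_le_mul' (ENNReal.inv_le_inv.2 (hlo n hn hpos.ne')) (hup k n hk hn)
      _ = ENNReal.ofReal (C / c * k * √(n : ℝ)) := by
          rw [← ENNReal.ofReal_inv_of_pos (by positivity), ← ENNReal.ofReal_mul (by positivity)]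
          congr 1
          field_simp
  · intro a b ha hab
    obtain ⟨c, hc, N, hlo⟩ := hG.exists_le_coeff_rootPairs a b ha (ha.trans_le hab)
    obtain ⟨C, hC, hup⟩ := hG.exists_coeff_treeGF_le
    -- The threshold `N + 1` ensures `n ≥ 1`, and then `k ≥ a√n > 0` gives `k ≥ 1`.
    refine ⟨c / C, by positivity, N + 1, fun k n hn hpos hak hkb => ?_⟩
    have hn0 : (0 : ℝ) < n := by exact_mod_cast (by omega : 0 < n)
    have hs0 : 0 < √(n : ℝ) := by positivity
    have hk : 1 ≤ k := by
      have : (0 : ℝ) < k := lt_of_lt_of_le (by positivity) hak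
      exact_mod_cast this
    rw [GaltonWatson.offspringLaw_sizeEvent] at hpos
    rw [GaltonWatson.expectedPairs_eq p hk]
    calc ENNReal.ofReal (c / C * k * √(n : ℝ))
        = (ENNReal.ofReal (C / (n * √(n : ℝ))))⁻¹ * ENNReal.ofReal (c * k / n) := by
          rw [← ENNReal.ofReal_inv_of_pos (by positivity), ← ENNReal.ofReal_mul (by positivity)]
          congr 1
          field_simp
      _ ≤ _ := mul_le_mul' (ENNReal.inv_le_inv.2 (hup n (by omega)))
          (hlo k n (by omega) hpos.ne' hak hkb)
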